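/- Let $n\ge 1$ and $k>2$ be integers, and let $\mathbb C_k[q]$ denote the finite-dimensional complex vector space of homogeneous polynomials (potentials) $V$ of degree $k$ in $q=(q_1,\dots,q_n)$, with its standard topology. A point $[d]\in\mathbb{CP}^{n-1}$ is a *Darboux point* of $V$ if the gradient satisfies $V'(d)=\gamma d$ for some $\gamma\in\mathbb C$; it is *proper* if moreover $V'(d)\neq 0$. The set $\mathcal D(V)$ of Darboux points is the common zero locus in $\mathbb{CP}^{n-1}$ of the homogeneous polynomials $R_{ij}=q_i\,\partial V/\partial q_j-q_j\,\partial V/\partial q_i$, $1\le i<j\le n$. A point $p$ of an affine algebraic set $X\subset\mathbb C^m$ defined by polynomials $f_1,\dots,f_s$ is *simple* if the rank of the Jacobi matrix $(\partial f_a/\partial x_b)(p)$ equals $m-\dim X_p$, where $X_p$ is the connected component of $X$ containing $p$; a Darboux point $[d]$ with $d_i\ne 0$ is *simple* if its image in the affine chart $q_i\neq 0$ is a simple point of the affine algebraic set defined by the dehomogenisations (set $q_i=1$) of the polynomials $R_{ab}$. The potential $V$ is *generic* if all its Darboux points are proper and simple. Then the set $\mathcal G_{n,k}\subset\mathbb C_k[q]$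 of generic potentials is a non-empty open subset of $\mathbb C_k[q]$, and every $V\in\mathcal G_{n,k}$ has exactly $$D(n,k)=\frac{(k-1)^n-1}{k-2}$$ proper Darboux points (in particular, finitely many). -/

import Mathlib

open scoped LinearAlgebra.Projectivization Topology

noncomputable section

namespace DarbouxPoints

open MvPolynomial

/-! ### Simple points of algebraic sets -/

section Simple

variable {σ κ : Type*}

/-- The affine algebraic set of common zeros in `ℂ^σ` of the polynomials `f a`. -/
def affineLocus (f : κ → MvPolynomial σ ℂ) : Set (σ → ℂ) :=
  {x | ∀ a, eval x (f a) = 0}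

/-- The Jacobi matrix of the polynomials `f a` at the point `x`. -/
def jacobiMatrix (f : κ → MvPolynomial σ ℂ) (x : σ → ℂ) : Matrix κ σ ℂ :=
  Matrix.of fun a j => eval x (pderiv j (f a))

/-- The dimension of an algebraic subset `S` of `ℂ^σ`: the Krull dimension of its coordinate
ring, the quotient of the polynomial ring by the ideal of polynomials vanishing on `S`. -/
def algDim (S : Set (σ → ℂ)) : WithBot ℕ∞ :=
  ringKrullDim (MvPolynomial σ ℂ ⧸ vanishingIdeal ℂ S)

/-- `x` is a simple point of the algebraic set `X` defined by the `f a`: it lies on `X`, and the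
rank of the Jacobi matrix at `x` equals `m - dim X_x`, where `m` is the number of variables and
`X_x` is the connected component of `X` containing `x`. (The equation is written without
subtraction.) -/
def IsSimplePoint [Fintype σ] (f : κ → MvPolynomial σ ℂ) (x : σ → ℂ) : Prop :=
  x ∈ affineLocus f ∧
    ((jacobiMatrix f x).rank : WithBot ℕ∞) + algDim (connectedComponentIn (affineLocus f) x) =
      (Fintype.card σ : WithBot ℕ∞)

end Simple

section Projective

variable {n : ℕ} {κ : Type*}

/-- Dehomogenisation with respect to the `i`-th variable: `q_i` is replaced by `1`. The
remaining variables are indexed by the `j ≠ i`. -/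
def dehomogenise (i : Fin n) :
    MvPolynomial (Fin n) ℂ →ₐ[ℂ] MvPolynomial {j : Fin n // j ≠ i} ℂ :=
  aeval fun j => if h : j = i then 1 else X ⟨j, h⟩

/-- Affine coordinates `q_j / q_i`, `j ≠ i`, of a point of the chart `q_i ≠ 0` of the projective
space of `ℂ^n`. They do not depend on the representative. -/
def chart (i : Fin n) (p : ℙ ℂ (Fin n → ℂ)) : {j : Fin n // j ≠ i} → ℂ :=
  fun j => p.rep j / p.rep i

/-- `p` is a simple point of the projective algebraic set defined by the homogeneous
polynomials `F a`: its image in an affine chart containing it is a simple point of the affine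
algebraic set defined by the dehomogenised polynomials. -/
def IsSimpleProjPoint (F : κ → MvPolynomial (Fin n) ℂ) (p : ℙ ℂ (Fin n → ℂ)) : Prop :=
  ∃ i : Fin n, p.rep i ≠ 0 ∧ IsSimplePoint (fun a => dehomogenise i (F a)) (chart i p)

end Projective

/-! ### Darboux points -/

section Darboux

variable {n : ℕ}

/-- The gradient `V'(d)` of a polynomial potential. -/
def grad (V : MvPolynomial (Fin n) ℂ) (d : Fin n → ℂ) : Fin n → ℂ :=
  fun j => eval d (pderiv j V)

/-- The set of Darboux points `[d]` of a homogeneous potential: `V'(d) = γ d` for some `γ`. -/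
def darbouxPoints (V : MvPolynomial (Fin n) ℂ) : Set (ℙ ℂ (Fin n → ℂ)) :=
  {p | ∃ γ : ℂ, grad V p.rep = γ • p.rep}

/-- The set of proper Darboux points: Darboux points with `V'(d) ≠ 0`. -/
def properDarbouxPoints (V : MvPolynomial (Fin n) ℂ) : Set (ℙ ℂ (Fin n → ℂ)) :=
  {p | p ∈ darbouxPoints V ∧ grad V p.rep ≠ 0}

/-- The polynomials `R_{ij} = q_i ∂V/∂q_j - q_j ∂V/∂q_i`, `i < j`, the components of
`q ∧ V'(q)`. Their common zero locus in the projective space is the set of Darboux points. -/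
def darbouxEq (V : MvPolynomial (Fin n) ℂ) (a : {a : Fin n × Fin n // a.1 < a.2}) :
    MvPolynomial (Fin n) ℂ :=
  X a.1.1 * pderiv a.1.2 V - X a.1.2 * pderiv a.1.1 V

/-- A potential is generic iff all its Darboux points are proper and simple. -/
def IsGeneric (V : MvPolynomial (Fin n) ℂ) : Prop :=
  ∀ p ∈ darbouxPoints V, p ∈ properDarbouxPoints V ∧ IsSimpleProjPoint (darbouxEq V) p

/-- The set of generic potentials of degree `k`, inside the space `ℂ_k[q]` of homogeneous
polynomials of degree `k` in `n` variables. -/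
def genericPotentials (n k : ℕ) : Set (homogeneousSubmodule (Fin n) ℂ k) :=
  {V | IsGeneric (V : MvPolynomial (Fin n) ℂ)}

/-- The gradient of a homogeneous potential is homogeneous. -/
theorem grad_smul {k : ℕ} {V : MvPolynomial (Fin n) ℂ} (hV : V.IsHomogeneous k) (c : ℂ)
    (d : Fin n → ℂ) : grad V (c • d) = c ^ (k - 1) • grad V d := by
  funext j
  have h : (pderiv j V).IsHomogeneous (k - 1) := hV.pderiv
  simp only [grad, Pi.smul_apply, smul_eq_mul, eval_eq, Finset.mul_sum]
  refine Finset.sum_congr rfl fun m hm => ?_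
  have hdeg : ∑ i ∈ m.support, m i = k - 1 := by
    have := h (mem_support_iff.mp hm)
    simpa [Finsupp.weight_apply, Finsupp.sum] using this
  simp only [mul_pow, Finset.prod_mul_distrib, Finset.prod_pow_eq_pow_sum, hdeg]
  ring

/-- Being a Darboux point does not depend on the representative. -/
theorem mk_mem_darbouxPoints_iff {k : ℕ} (hk : 2 < k) {V : MvPolynomial (Fin n) ℂ}
    (hV : V.IsHomogeneous k) (d : Fin n → ℂ) (hd : d ≠ 0) :
    Projectivization.mk ℂ d hd ∈ darbouxPoints V ↔ ∃ γ : ℂ, grad V d = γ • d := by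
  obtain ⟨a, ha⟩ := Projectivization.exists_smul_eq_mk_rep ℂ d hd
  have ha0 : (a : ℂ) ≠ 0 := a.ne_zero
  have hp : (a : ℂ) ^ (k - 1) = (a : ℂ) ^ (k - 2) * a := by
    rw [← pow_succ]; congr 1; omega
  change (∃ γ : ℂ, grad V (Projectivization.mk ℂ d hd).rep = _) ↔ _
  rw [← ha, Units.smul_def, grad_smul hV, hp]
  constructor
  · rintro ⟨γ, h⟩
    refine ⟨((a : ℂ) ^ (k - 2))⁻¹ * γ, ?_⟩
    have h2 := congrArg (fun w => ((a : ℂ) ^ (k - 2) * a)⁻¹ • w) h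
    simp only [smul_smul] at h2
    rw [inv_mul_cancel₀ (mul_ne_zero (pow_ne_zero _ ha0) ha0), one_smul] at h2
    rw [h2]
    congr 1
    field_simp
  · rintro ⟨γ, h⟩
    refine ⟨(a : ℂ) ^ (k - 2) * γ, ?_⟩
    rw [h, smul_smul, smul_smul]
    congr 1
    ring

/-- Being a proper Darboux point does not depend on the representative. -/
theorem mk_mem_properDarbouxPoints_iff {k : ℕ} (hk : 2 < k) {V : MvPolynomial (Fin n) ℂ}
    (hV : V.IsHomogeneous k) (d : Fin n → ℂ) (hd : d ≠ 0) :
    Projectivization.mk ℂ d hd ∈ properDarbouxPoints V ↔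
      (∃ γ : ℂ, grad V d = γ • d) ∧ grad V d ≠ 0 := by
  obtain ⟨a, ha⟩ := Projectivization.exists_smul_eq_mk_rep ℂ d hd
  change (Projectivization.mk ℂ d hd ∈ darbouxPoints V ∧ _) ↔ _
  rw [mk_mem_darbouxPoints_iff hk hV, ← ha, Units.smul_def, grad_smul hV,
    smul_ne_zero_iff_right (pow_ne_zero _ a.ne_zero)]

end Darboux

/-- `D(n,k) = ((k-1)^n - 1)/(k-2)`, as a rational number. -/
def D (n k : ℕ) : ℚ := (((k : ℚ) - 1) ^ n - 1) / ((k : ℚ) - 2)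

end DarbouxPoints

end

noncomputable section

namespace DarbouxPoints

open MvPolynomial

/-! ### Finiteness of the polynomial ring over `ℂ[F]`, with degree control -/

section Filtration

variable {σ : Type*}

/-! Genericity is first turned into linear algebra. By Euler's identity, V'(d) = γd implies (V''(d)
- γ)d = (k-2)γd. Hence invertibility of V''(d) - γ at every such d ≠ 0 already forces γ ≠ 0, that
is, properness. Conversely, if V' has no nontrivial zero, the Darboux locus in each chart is finite,
so a simple point is one where the Jacobi matrix has full column rank. That matrix is v ↦ d ∧
(V''(d) - γ)v on a complement of the line ℂd, and since d is an eigenvector with nonzero eigenvalue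
(k-2)γ, full rank means det(V''(d) - γ) ≠ 0. This gives `isGeneric_iff_isNondegenerate`.

The count comes from the affine system V'(d) = d. It has n equations of degree k-1 whose leading
forms have no common nontrivial zero, and all its zeros are nondegenerate, so Bézout
(`ncard_affineLocus`) gives (k-1)^n solutions. Removing d = 0 and dividing by the scaling action of
the (k-2)-th roots of unity leaves the proper Darboux points.

Bézout is proved by comparing dimensions. Let F have degree m and N nondegenerate zeros, and let g_z
be interpolation polynomials at these zeros. Local inverses of F show that the g_z are independent
over ℂ[F], so N copies of the polynomials of degree ≤ s embed in degree ≤ ms + e. Nakayama's lemma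
shows that some r ≠ 0 multiplies the whole ring into the ℂ[F]-span of the g_z, and the
degree-compatible finiteness `exists_restrictTotalDegree_le` turns this into the reverse estimate.
Comparing the terms of order s^n yields N = m^n.

Openness holds because nondegeneracy can be tested on a compact sphere by conditions continuous in
(V, d). The Fermat potential ∑ q_j^k is nondegenerate, so the set is not empty. -/

theorem homogeneousComponent_mul_of_isHomogeneous {d m : ℕ} (a : MvPolynomial σ ℂ)
    {b : MvPolynomial σ ℂ} (hb : b.IsHomogeneous m) :
    homogeneousComponent (d + m) (a * b) = homogeneousComponent d a * b := by
  let _ : GradedAlgebra (homogeneousSubmodule σ ℂ) := gradedAlgebra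
  have := DirectSum.coe_decompose_mul_add_of_right_mem (homogeneousSubmodule σ ℂ) (i := d)
    (j := m) (a := a) (b := b) hb
  exact (decomposition.decompose'_apply (a * b) (d + m)).symm.trans
    (this.trans (congrArg (· * b) (decomposition.decompose'_apply a d)))

/-- In an arbitrary expression of `p` through the `f i`, only the degree `d` components of the
coefficients contribute in degree `d + m`. -/
theorem exists_isHomogeneous_eq_sum_mul [Fintype σ] {m d : ℕ} {f : σ → MvPolynomial σ ℂ}
    (hf : ∀ i, (f i).IsHomogeneous m) {p : MvPolynomial σ ℂ} (hp : p.IsHomogeneous (d + m))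
    (hpI : p ∈ Ideal.span (Set.range f)) :
    ∃ a : σ → MvPolynomial σ ℂ, (∀ i, (a i).IsHomogeneous d) ∧ p = ∑ i, a i * f i := by
  obtain ⟨c, hc⟩ := (Ideal.mem_span_range_iff_exists_fun).1 hpI
  refine ⟨fun i => homogeneousComponent d (c i),
    fun i => homogeneousComponent_isHomogeneous d (c i), ?_⟩
  rw [← homogeneousComponent_eq_self hp, ← hc, map_sum]
  exact Finset.sum_congr rfl fun i _ => homogeneousComponent_mul_of_isHomogeneous _ (hf i)

/-- Forms without a common non-trivial zero generate all forms of large degree. -/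
theorem exists_forall_isHomogeneous_mem_span [Finite σ] {f : σ → MvPolynomial σ ℂ}
    (hf : ∀ x : σ → ℂ, (∀ i, eval x (f i) = 0) → x = 0) :
    ∃ N, ∀ d, N ≤ d → ∀ p : MvPolynomial σ ℂ, p.IsHomogeneous d →
      p ∈ Ideal.span (Set.range f) := by
  -- Nullstellensatz: the zero locus lies in the origin, where all variables vanish.
  have h : idealOfVars σ ℂ ≤ (Ideal.span (Set.range f)).radical := by
    rw [← vanishingIdeal_zeroLocus_eq_radical (K := ℂ), zeroLocus_span, idealOfVars,
      Ideal.span_le]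
    rintro _ ⟨i, rfl⟩ x hx
    have : x = 0 := hf x fun i => by simpa using hx (f i) ⟨i, rfl⟩
    simp [this]
  obtain ⟨N, hN⟩ := Ideal.exists_pow_le_of_le_radical_of_fg h (idealOfVars_fg σ ℂ)
  refine ⟨N, fun d hd p hp => hN ?_⟩
  rw [mem_pow_idealOfVars_iff]
  intro x hx
  exact hd.trans (hp.degree_eq_sum_deg_support hx).le

/-- The polynomials of degree at most `s` in the polynomials `F i`. -/
def degreeLEIn (F : σ → MvPolynomial σ ℂ) (s : ℕ) : Submodule ℂ (MvPolynomial σ ℂ) :=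
  (restrictTotalDegree σ ℂ s).map (aeval F : MvPolynomial σ ℂ →ₐ[ℂ] _).toLinearMap

theorem restrictTotalDegree_mono {s t : ℕ} (h : s ≤ t) :
    restrictTotalDegree σ ℂ s ≤ restrictTotalDegree σ ℂ t := fun p hp => by
  rw [mem_restrictTotalDegree] at *
  omega

theorem degreeLEIn_mono (F : σ → MvPolynomial σ ℂ) {s t : ℕ} (h : s ≤ t) :
    degreeLEIn F s ≤ degreeLEIn F t :=
  Submodule.map_mono (restrictTotalDegree_mono h)

theorem degreeLEIn_mul_le (F : σ → MvPolynomial σ ℂ) (s t : ℕ) :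
    degreeLEIn F s * degreeLEIn F t ≤ degreeLEIn F (s + t) := by
  rw [Submodule.mul_le]
  rintro _ ⟨p, hp, rfl⟩ _ ⟨q, hq, rfl⟩
  refine ⟨p * q, ?_, by simp⟩
  simp only [SetLike.mem_coe, mem_restrictTotalDegree] at *
  exact (totalDegree_mul p q).trans (by omega)

theorem one_mem_degreeLEIn (F : σ → MvPolynomial σ ℂ) (s : ℕ) : 1 ∈ degreeLEIn F s :=
  ⟨1, by simp [mem_restrictTotalDegree], by simp⟩

theorem mem_degreeLEIn_one (F : σ → MvPolynomial σ ℂ) (i : σ) : F i ∈ degreeLEIn F 1 :=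
  ⟨X i, by simp [mem_restrictTotalDegree], by simp⟩

/-- If the leading forms of the `F i` have no common non-trivial zero, the polynomial ring is a
finite module over the algebra generated by the `F i`, compatibly with degrees. -/
theorem exists_restrictTotalDegree_le [Fintype σ] {m : ℕ} (hm : 0 < m)
    {f F : σ → MvPolynomial σ ℂ} (hf : ∀ i, (f i).IsHomogeneous m)
    (hf0 : ∀ x : σ → ℂ, (∀ i, eval x (f i) = 0) → x = 0)
    (hF : ∀ i, (F i - f i).totalDegree < m) :
    ∃ E, ∀ D, restrictTotalDegree σ ℂ D ≤
      degreeLEIn F (D / m) * restrictTotalDegree σ ℂ E := by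
  obtain ⟨N, hN⟩ := exists_forall_isHomogeneous_mem_span hf0
  refine ⟨N + m, fun D => ?_⟩
  induction D using Nat.strong_induction_on with
  | _ D ih =>
  intro p hp
  rw [mem_restrictTotalDegree] at hp
  rcases le_or_gt D (N + m) with hD | hD
  · rw [← one_mul p]
    exact Submodule.mul_mem_mul (one_mem_degreeLEIn F _)
      ((mem_restrictTotalDegree σ _ _).2 (hp.trans hD))
  obtain ⟨d, rfl⟩ : ∃ d, D = d + m := ⟨D - m, by omega⟩
  obtain ⟨a, ha, hpa⟩ := exists_isHomogeneous_eq_sum_mul hf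
    (homogeneousComponent_isHomogeneous (d + m) p)
    (hN (d + m) (by omega) _ (homogeneousComponent_isHomogeneous (d + m) p))
  -- Replacing `f i` by `F i` in the top component of `p` changes only lower degrees, so induction
  -- applies to the remainder and to each `a i`. The factor `F i` costs one degree in `F`, matching
  -- `(d + m) / m = d / m + 1`.
  have hlow : (p - ∑ i, a i * F i).totalDegree < d + m := by
    have h1 : p - ∑ i, a i * F i = (p - homogeneousComponent (d + m) p) -
        ∑ i, a i * (F i - f i) := by
      rw [hpa]; simp only [mul_sub, Finset.sum_sub_distrib]; ring
    have h2 : (p - homogeneousComponent (d + m) p).totalDegree ≤ d + m - 1 := by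
      rw [totalDegree, Finset.sup_le_iff]
      intro s hs
      rw [mem_support_iff, coeff_sub, coeff_homogeneousComponent] at hs
      change s.degree ≤ _
      by_cases h : s.degree = d + m
      · simp [h] at hs
      · simp only [h, if_false, sub_zero] at hs
        have : s.degree ≤ p.totalDegree := le_totalDegree (mem_support_iff.2 hs)
        omega
    have h3 : (∑ i, a i * (F i - f i)).totalDegree ≤ d + m - 1 := by
      refine totalDegree_finsetSum_le fun i _ => (totalDegree_mul _ _).trans ?_
      have := hF i
      have := (ha i).totalDegree_le
      omega
    rw [h1]
    have := totalDegree_sub (p - homogeneousComponent (d + m) p) (∑ i, a i * (F i - f i))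
    omega
  have hlow' : p - ∑ i, a i * F i ∈ degreeLEIn F ((d + m) / m) * restrictTotalDegree σ ℂ (N + m) :=
    mul_le_mul_left (degreeLEIn_mono F (Nat.div_le_div_right (by omega))) _
      (ih (d + m - 1) (by omega) ((mem_restrictTotalDegree σ _ _).2 (by omega)))
  rw [← sub_add_cancel p (∑ i, a i * F i)]
  refine Submodule.add_mem _ hlow' (Submodule.sum_mem _ fun i _ => ?_)
  have hai : a i ∈ degreeLEIn F (d / m) * restrictTotalDegree σ ℂ (N + m) :=
    ih d (by omega) ((mem_restrictTotalDegree σ _ _).2 (ha i).totalDegree_le)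
  have h : F i * a i ∈
      degreeLEIn F 1 * (degreeLEIn F (d / m) * restrictTotalDegree σ ℂ (N + m)) :=
    Submodule.mul_mem_mul (mem_degreeLEIn_one F i) hai
  have hle : degreeLEIn F 1 * degreeLEIn F (d / m) ≤ degreeLEIn F (d / m + 1) :=
    (degreeLEIn_mul_le F _ _).trans (degreeLEIn_mono F (by omega))
  rw [mul_comm (a i), Nat.add_div_right d hm]
  rw [← mul_assoc] at h
  have hle' : degreeLEIn F 1 * degreeLEIn F (d / m) * restrictTotalDegree σ ℂ (N + m) ≤
      degreeLEIn F (d / m + 1) * restrictTotalDegree σ ℂ (N + m) := mul_le_mul_left hle _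
  exact hle' h

theorem degreeLEIn_le_restrictTotalDegree {m : ℕ} {F : σ → MvPolynomial σ ℂ}
    (hF : ∀ i, (F i).totalDegree ≤ m) (s : ℕ) :
    degreeLEIn F s ≤ restrictTotalDegree σ ℂ (m * s) := by
  rintro _ ⟨p, hp, rfl⟩
  rw [SetLike.mem_coe, mem_restrictTotalDegree] at hp
  rw [AlgHom.toLinearMap_apply, mem_restrictTotalDegree, aeval_def, eval₂_eq]
  refine totalDegree_finsetSum_le fun d hd => (totalDegree_mul _ _).trans ?_
  rw [algebraMap_eq, totalDegree_C, zero_add]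
  refine (totalDegree_finsetProd _ _).trans ((Finset.sum_le_sum fun i _ =>
    (totalDegree_pow _ _).trans (Nat.mul_le_mul_left _ (hF i))).trans ?_)
  rw [← Finset.sum_mul, mul_comm]
  exact Nat.mul_le_mul_left _ ((le_totalDegree hd).trans hp)

/-- The dimension of the space of polynomials of degree at most `D`. -/
theorem finrank_restrictTotalDegree [Fintype σ] (D : ℕ) :
    Module.finrank ℂ (restrictTotalDegree σ ℂ D) =
      (D + Fintype.card σ).choose (Fintype.card σ) := by
  classical
  -- The extra coordinate `none` is a slack variable that turns degree at most `D` into degree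
  -- exactly `D`, ready for stars and bars.
  let e : {s : σ →₀ ℕ | (s.sum fun _ e => e) ≤ D} ≃
      (Finset.univ : Finset (Option σ)).finsuppAntidiag D :=
    { toFun := fun s => ⟨s.1.optionElim (D - s.1.sum fun _ e => e), by
        have := s.2
        rw [Set.mem_ofPred, Finsupp.sum_fintype _ _ fun _ => rfl] at this
        simp [Finset.mem_finsuppAntidiag, Finsupp.sum_fintype, this]⟩
      invFun := fun s => ⟨s.1.some, by
        have := (Finset.mem_finsuppAntidiag.1 s.2).1
        rw [Fintype.sum_option] at this
        rw [Set.mem_ofPred, Finsupp.sum_fintype _ _ fun _ => rfl]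
        simp only [Finsupp.some_apply]
        omega⟩
      left_inv := fun s => Subtype.ext (by simp)
      right_inv := fun s => Subtype.ext (by
        have := (Finset.mem_finsuppAntidiag.1 s.2).1
        rw [Fintype.sum_option] at this
        change s.1.some.optionElim (D - s.1.some.sum fun _ e => e) = s.1
        conv_rhs => rw [← Finsupp.optionElim_some s.1]
        congr 1
        rw [Finsupp.sum_fintype _ _ fun _ => rfl]
        simp only [Finsupp.some_apply]
        omega) }
  rw [restrictTotalDegree, Module.finrank_eq_nat_card_basis (basisRestrictSupport ℂ _), Nat.card_congr e,
    Nat.card_eq_fintype_card, Fintype.card_coe, Finset.card_finsuppAntidiag_nat_eq_choose]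
  rw [Finset.card_univ, Fintype.card_option, add_right_comm, Nat.add_sub_cancel, add_comm D,
    Nat.choose_symm_add]

end Filtration

/-! ### Finiteness of the zero set, and the ideal of nondegenerate zeros -/

section Zeros

variable {σ : Type*}

theorem mem_vanishingIdeal_singleton_iff_eval {z : σ → ℂ} {p : MvPolynomial σ ℂ} :
    p ∈ (vanishingIdeal ℂ {z} : Ideal (MvPolynomial σ ℂ)) ↔ eval z p = 0 :=
  mem_vanishingIdeal_singleton_iff z p

theorem exists_eval_eq_one_eval_eq_zero {z w : σ → ℂ} (h : z ≠ w) :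
    ∃ p : MvPolynomial σ ℂ, eval z p = 1 ∧ eval w p = 0 := by
  obtain ⟨i, hi⟩ := Function.ne_iff.1 h
  refine ⟨C (z i - w i)⁻¹ * (X i - C (w i)), ?_, by simp⟩
  simp [inv_mul_cancel₀ (sub_ne_zero.2 hi)]

/-- Interpolation polynomials of a finite set of points. -/
theorem exists_interpolation [DecidableEq (σ → ℂ)] (Z : Finset (σ → ℂ)) :
    ∃ g : (σ → ℂ) → MvPolynomial σ ℂ, ∀ z ∈ Z, ∀ w ∈ Z, eval z (g w) = if z = w then 1 else 0 := by
  choose p hp using fun z w : σ → ℂ => fun h : z ≠ w => exists_eval_eq_one_eval_eq_zero h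
  refine ⟨fun w => ∏ z ∈ Z, if h : w ≠ z then p w z h else 1, fun z hz w hw => ?_⟩
  rw [eval_prod]
  split_ifs with h
  · subst h
    refine Finset.prod_eq_one fun v _ => ?_
    split_ifs with h
    · exact (hp _ _ h).1
    · simp
  · refine Finset.prod_eq_zero hz ?_
    rw [dif_pos (Ne.symm h)]
    exact (hp _ _ _).2

theorem eval_aeval_of_mem_affineLocus {F : σ → MvPolynomial σ ℂ} {z : σ → ℂ}
    (hz : z ∈ affineLocus F) (b : MvPolynomial σ ℂ) : eval z (aeval F b) = eval 0 b := by
  have : (aeval z).comp (aeval F) = (aeval (0 : σ → ℂ) : MvPolynomial σ ℂ →ₐ[ℂ] ℂ) := by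
    ext i
    simpa using hz i
  simpa [coe_aeval_eq_eval] using DFunLike.congr_fun this b

/-- A polynomial in the `F i` is constant on their common zeros, so its factor can be replaced by a
scalar there. -/
theorem exists_forall_eval_eq {F : σ → MvPolynomial σ ℂ} {s E : ℕ} {p : MvPolynomial σ ℂ}
    (hp : p ∈ degreeLEIn F s * restrictTotalDegree σ ℂ E) :
    ∃ w ∈ restrictTotalDegree σ ℂ E, ∀ z ∈ affineLocus F, eval z p = eval z w := by
  induction hp using Submodule.mul_induction_on' with
  | mem_mul_mem a ha w hw =>
    obtain ⟨b, -, rfl⟩ := ha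
    refine ⟨eval 0 b • w, Submodule.smul_mem _ _ hw, fun z hz => ?_⟩
    rw [AlgHom.toLinearMap_apply, map_mul, eval_aeval_of_mem_affineLocus hz, smul_eval]
  | add x _ y _ hx hy =>
    obtain ⟨v, hv, hv'⟩ := hx
    obtain ⟨w, hw, hw'⟩ := hy
    exact ⟨v + w, Submodule.add_mem _ hv hw, fun z hz => by
      rw [map_add, map_add, hv' z hz, hw' z hz]⟩

/-- Any function on finitely many zeros is interpolated by a polynomial of degree at most `E`, so
the dimension of that space bounds the number of zeros. -/
theorem finite_affineLocus [Finite σ] {F : σ → MvPolynomial σ ℂ} {E : ℕ} {d : ℕ → ℕ}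
    (hE : ∀ D, restrictTotalDegree σ ℂ D ≤ degreeLEIn F (d D) * restrictTotalDegree σ ℂ E) :
    (affineLocus F).Finite := by
  classical
  by_contra hinf
  obtain ⟨Z, hZ, hcard⟩ := Set.Infinite.exists_subset_card_eq hinf
    (Module.finrank ℂ (restrictTotalDegree σ ℂ E) + 1)
  obtain ⟨g, hg⟩ := exists_interpolation Z
  choose w hw hwz using fun z : σ → ℂ => exists_forall_eval_eq
    (hE _ ((mem_restrictTotalDegree σ _ (g z)).2 le_rfl))
  have hli : LinearIndependent ℂ fun z : Z => (⟨w z, hw z⟩ : restrictTotalDegree σ ℂ E) := by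
    rw [Fintype.linearIndependent_iff]
    intro c hc z
    have := congrArg (fun p : restrictTotalDegree σ ℂ E => eval (z : σ → ℂ) p.1) hc
    simp only [Submodule.coe_sum, Submodule.coe_smul, map_sum, smul_eval, ZeroMemClass.coe_zero,
      map_zero] at this
    rw [Finset.sum_eq_single z] at this
    · rw [← hwz z z (hZ z.2), hg z z.2 z z.2] at this
      simpa using this
    · intro v _ hv
      rw [← hwz v z (hZ z.2), hg z z.2 v v.2, if_neg fun h => hv (Subtype.ext h.symm), mul_zero]
    · simp
  have := hli.fintype_card_le_finrank
  rw [Fintype.card_coe, hcard] at this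
  omega

/-- First order Taylor expansion. -/
theorem sub_sum_mem_sq [Fintype σ] (z : σ → ℂ) (p : MvPolynomial σ ℂ) :
    p - C (eval z p) - ∑ j, C (eval z (pderiv j p)) * (X j - C (z j)) ∈
      (vanishingIdeal ℂ {z} : Ideal (MvPolynomial σ ℂ)) ^ 2 := by
  classical
  have hX : ∀ j, X j - C (z j) ∈ (vanishingIdeal ℂ {z} : Ideal (MvPolynomial σ ℂ)) := fun j => by
    rw [mem_vanishingIdeal_singleton_iff_eval]; simp
  induction p using MvPolynomial.induction_on with
  | C a => simp
  | add p q hp hq =>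
    convert! Ideal.add_mem _ hp hq using 1
    simp only [map_add, add_mul, Finset.sum_add_distrib]
    ring
  | mul_X p i hp =>
    have h1 : ∑ j, C (eval z (pderiv j (p * X i))) * (X j - C (z j)) =
        C (z i) * ∑ j, C (eval z (pderiv j p)) * (X j - C (z j)) +
          C (eval z p) * (X i - C (z i)) := by
      simp only [pderiv_mul, map_add, map_mul, eval_X, pderiv_X, Finset.mul_sum]
      simp only [add_mul, Finset.sum_add_distrib]
      congr 1
      · exact Finset.sum_congr rfl fun j _ => by ring
      · rw [Finset.sum_eq_single i]
        · simp
        · intro j _ hj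
          simp [Pi.single_eq_of_ne' hj]
        · simp
    have h2 : p - C (eval z p) ∈ (vanishingIdeal ℂ {z} : Ideal (MvPolynomial σ ℂ)) := by
      rw [mem_vanishingIdeal_singleton_iff_eval]; simp
    have h3 := Ideal.mul_mem_mul h2 (hX i)
    rw [← pow_two] at h3
    convert! Ideal.add_mem _ (Ideal.mul_mem_left _ (C (z i)) hp) h3 using 1
    rw [h1, map_mul, eval_X, map_mul]
    ring

/-- Modulo the square of the maximal ideal, each `F i` equals its linear part at `z`. Inverting the
Jacobi matrix recovers every `X k - C (z k)` from these. -/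
theorem vanishingIdeal_singleton_le [Fintype σ] [DecidableEq σ] {F : σ → MvPolynomial σ ℂ}
    {z : σ → ℂ} (hz : z ∈ affineLocus F) (hdet : (jacobiMatrix F z).det ≠ 0) :
    (vanishingIdeal ℂ {z} : Ideal (MvPolynomial σ ℂ)) ≤
      Ideal.span (Set.range F) ⊔ vanishingIdeal ℂ {z} ^ 2 := by
  set I : Ideal (MvPolynomial σ ℂ) := Ideal.span (Set.range F)
  set K : Ideal (MvPolynomial σ ℂ) := I ⊔ vanishingIdeal ℂ {z} ^ 2
  have hlin : ∀ i, ∑ j, C (jacobiMatrix F z i j) * (X j - C (z j)) ∈ K := fun i => by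
    have h1 := sub_sum_mem_sq z (F i)
    rw [show eval z (F i) = 0 from hz i, map_zero, sub_zero] at h1
    have h2 : F i ∈ K := Ideal.mem_sup_left (Ideal.subset_span ⟨i, rfl⟩)
    have h3 := Ideal.sub_mem _ h2 (Ideal.mem_sup_right h1 : _ ∈ K)
    simpa [jacobiMatrix] using h3
  have hX : ∀ k, X k - C (z k) ∈ K := fun k => by
    have h1 : ∑ i, C ((jacobiMatrix F z)⁻¹ k i) *
        ∑ j, C (jacobiMatrix F z i j) * (X j - C (z j)) = X k - C (z k) := by
      simp only [Finset.mul_sum]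
      rw [Finset.sum_comm]
      simp only [← mul_assoc, ← map_mul, ← Finset.sum_mul, ← map_sum]
      have h2 : ∀ j, ∑ i, (jacobiMatrix F z)⁻¹ k i * jacobiMatrix F z i j =
          (1 : Matrix σ σ ℂ) k j := fun j => by
        rw [← Matrix.nonsing_inv_mul _ (isUnit_iff_ne_zero.2 hdet), Matrix.mul_apply]
      simp only [h2, Matrix.one_apply]
      simp
    rw [← h1]
    exact Ideal.sum_mem _ fun i _ => Ideal.mul_mem_left _ _ (hlin i)
  intro p hp
  have h1 := sub_sum_mem_sq z p
  rw [mem_vanishingIdeal_singleton_iff_eval] at hp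
  rw [hp, map_zero, sub_zero] at h1
  rw [← sub_add_cancel p (∑ j, C (eval z (pderiv j p)) * (X j - C (z j)))]
  exact Ideal.add_mem _ (Ideal.mem_sup_right h1)
    (Ideal.sum_mem _ fun j _ => Ideal.mul_mem_left _ _ (hX j))

theorem prod_le_sup_prod_sq {R ι : Type*} [CommRing R] (I : Ideal R) (M : ι → Ideal R)
    (s : Finset ι) (h : ∀ i ∈ s, M i ≤ I ⊔ M i ^ 2) :
    ∏ i ∈ s, M i ≤ I ⊔ (∏ i ∈ s, M i) ^ 2 := by
  classical
  induction s using Finset.induction_on with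
  | empty => simp [Ideal.one_eq_top, Ideal.top_pow]
  | insert a s ha ih =>
    rw [Finset.prod_insert ha, mul_pow]
    refine (Ideal.mul_mono (h a (by simp)) (ih fun i hi => h i (by simp [hi]))).trans ?_
    simp only [Ideal.sup_mul, Ideal.mul_sup]
    exact sup_le (sup_le (Ideal.mul_le_right.trans le_sup_left)
      (Ideal.mul_le_right.trans le_sup_left))
      (sup_le (Ideal.mul_le_left.trans le_sup_left) le_sup_right)

/-- Finitely many polynomials with only finitely many common zeros, all of them nondegenerate,
generate the ideal of polynomials vanishing at these zeros. -/
theorem mem_span_of_forall_eval_eq_zero [Fintype σ] [DecidableEq σ] {F : σ → MvPolynomial σ ℂ}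
    (hfin : (affineLocus F).Finite) (hdet : ∀ z ∈ affineLocus F, (jacobiMatrix F z).det ≠ 0)
    {h : MvPolynomial σ ℂ} (hh : ∀ z ∈ affineLocus F, eval z h = 0) :
    h ∈ Ideal.span (Set.range F) := by
  set I : Ideal (MvPolynomial σ ℂ) := Ideal.span (Set.range F) with hI
  set N : Ideal (MvPolynomial σ ℂ) := ∏ z ∈ hfin.toFinset, vanishingIdeal ℂ {z}
  have hNinf : N = ⨅ z ∈ hfin.toFinset, vanishingIdeal ℂ {z} := by
    refine Ideal.prod_eq_iInf_of_pairwise_isCoprime fun z _ w _ hzw => ?_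
    refine Ideal.isCoprime_iff_sup_eq.2 (Ideal.IsMaximal.coprime_of_ne inferInstance inferInstance
      fun heq => ?_)
    obtain ⟨p, hp1, hp0⟩ := exists_eval_eq_one_eval_eq_zero hzw
    have : p ∈ (vanishingIdeal ℂ {w} : Ideal (MvPolynomial σ ℂ)) :=
      mem_vanishingIdeal_singleton_iff_eval.2 hp0
    exact one_ne_zero (hp1.symm.trans (mem_vanishingIdeal_singleton_iff_eval.1 (heq.ge this)))
  have hmem : ∀ p, p ∈ N ↔ ∀ z ∈ affineLocus F, eval z p = 0 := fun p => by
    rw [hNinf]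
    simp only [Submodule.mem_iInf, mem_vanishingIdeal_singleton_iff_eval,
      Set.Finite.mem_toFinset]
  have hrad : N ≤ I.radical := by
    rw [← vanishingIdeal_zeroLocus_eq_radical (K := ℂ), hI, zeroLocus_span]
    intro p hp x hx
    exact (hmem p).1 hp x fun i => hx _ ⟨i, rfl⟩
  obtain ⟨k, hk⟩ := Ideal.exists_pow_le_of_le_radical_of_fg hrad (IsNoetherian.noetherian N)
  have hsq : N ≤ I ⊔ N ^ 2 := prod_le_sup_prod_sq I _ _ fun z hz =>
    vanishingIdeal_singleton_le (by simpa using hz) (hdet z (by simpa using hz))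
  -- Iterating `N ≤ I ⊔ N ^ 2` pushes the error into arbitrarily high powers of `N`, and a high
  -- enough power lies in `I` by the Nullstellensatz.
  have hpow : ∀ j, N ≤ I ⊔ N ^ (j + 1) := fun j => by
    induction j with
    | zero => simp
    | succ j ih =>
      refine ih.trans (sup_le le_sup_left ?_)
      calc N ^ (j + 1) = N ^ j * N := pow_succ N j
        _ ≤ N ^ j * (I ⊔ N ^ 2) := Ideal.mul_mono_right hsq
        _ = N ^ j * I ⊔ N ^ (j + 1 + 1) := by rw [Ideal.mul_sup, ← pow_add]
        _ ≤ I ⊔ N ^ (j + 1 + 1) := sup_le_sup_right Ideal.mul_le_right _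
  have hle : N ≤ I := (hpow k).trans (sup_le le_rfl ((Ideal.pow_le_pow_right k.le_succ).trans hk))
  exact hle ((hmem h).2 hh)

end Zeros

/-! ### Lower bound for `m ^ n`: independence of the interpolation polynomials -/

section Counting

variable {σ : Type*}

theorem hasStrictFDerivAt_eval [Fintype σ] (p : MvPolynomial σ ℂ) (x : σ → ℂ) :
    HasStrictFDerivAt (fun y : σ → ℂ => eval y p)
      (∑ j, eval x (pderiv j p) • (ContinuousLinearMap.proj j : (σ → ℂ) →L[ℂ] ℂ)) x := by
  classical
  induction p using MvPolynomial.induction_on with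
  | C a => simpa using (hasStrictFDerivAt_const (𝕜 := ℂ) a x).congr_fderiv (by ext; simp)
  | add p q hp hq =>
    simp only [map_add]
    exact (hp.fun_add hq).congr_fderiv (by ext; simp [add_mul, Finset.sum_add_distrib])
  | mul_X p i hp =>
    have hi : HasStrictFDerivAt (fun y : σ → ℂ => y i)
      (ContinuousLinearMap.proj i : (σ → ℂ) →L[ℂ] ℂ) x := hasStrictFDerivAt_apply i x
    simp only [map_mul, eval_X]
    refine (hp.mul hi).congr_fderiv ?_
    ext v
    have h1 : ∀ j, eval x (pderiv j (p * X i)) * v j =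
        eval x p * (Pi.single (M := fun _ => ℂ) i 1 j * v j) +
          x i * (eval x (pderiv j p) * v j) := fun j => by
      rw [pderiv_mul, pderiv_X, map_add, map_mul, map_mul, eval_X]
      rcases eq_or_ne j i with rfl | hj
      · simp; ring
      · simp [hj, hj.symm]; ring
    simp [-Derivation.leibniz, h1, Finset.sum_add_distrib, Finset.mul_sum, Pi.single_apply]

/-- A local inverse of a polynomial map near a nondegenerate zero. -/
theorem exists_local_inverse [Fintype σ] [DecidableEq σ] {F : σ → MvPolynomial σ ℂ}
    {z : σ → ℂ} (hz : z ∈ affineLocus F) (hdet : (jacobiMatrix F z).det ≠ 0) :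
    ∃ φ : (σ → ℂ) → σ → ℂ, Filter.Tendsto φ (𝓝 0) (𝓝 z) ∧
      ∀ᶠ y in 𝓝 0, ∀ i, eval (φ y) (F i) = y i := by
  let L : (σ → ℂ) ≃L[ℂ] (σ → ℂ) := ((jacobiMatrix F z).toLinearEquiv' (by
    exact (Matrix.isUnit_iff_isUnit_det _).2 (isUnit_iff_ne_zero.2 hdet) |>.invertible)
    ).toContinuousLinearEquiv
  have hL : HasStrictFDerivAt (fun y : σ → ℂ => fun i => eval y (F i))
      (L : (σ → ℂ) →L[ℂ] (σ → ℂ)) z := by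
    rw [hasStrictFDerivAt_pi']
    intro i
    refine (hasStrictFDerivAt_eval (F i) z).congr_fderiv ?_
    ext v
    change _ = (jacobiMatrix F z).mulVec v i
    simp [Matrix.mulVec, dotProduct, jacobiMatrix]
  have h0 : (fun i => eval z (F i)) = 0 := funext hz
  refine ⟨hL.localInverse, ?_, ?_⟩
  · simpa only [h0] using hL.localInverse_tendsto
  · have := hL.eventually_right_inverse
    simp only [h0] at this
    exact this.mono fun y hy i => congrFun hy i

theorem eq_zero_of_eventually_eval_eq_zero [Fintype σ] {p : MvPolynomial σ ℂ}
    (h : ∀ᶠ y in 𝓝 (0 : σ → ℂ), eval y p = 0) : p = 0 := by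
  rw [Metric.eventually_nhds_iff_ball] at h
  obtain ⟨ε, hε, h⟩ := h
  refine funext_set (fun _ => Metric.ball (0 : ℂ) ε)
    (fun _ => infinite_of_mem_nhds 0 (Metric.ball_mem_nhds 0 hε)) fun x hx => ?_
  rw [map_zero]
  refine h x ?_
  rw [ball_pi _ hε]
  exact hx

/-- Interpolation polynomials of nondegenerate zeros of the `F i` are linearly independent over
the algebra of polynomials in the `F i`. -/
theorem eq_zero_of_sum_aeval_mul_eq_zero [Fintype σ] [DecidableEq σ] [DecidableEq (σ → ℂ)]
    {F : σ → MvPolynomial σ ℂ} {Z : Finset (σ → ℂ)}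
    (hZ : ∀ z ∈ Z, z ∈ affineLocus F) (hdet : ∀ z ∈ Z, (jacobiMatrix F z).det ≠ 0)
    {g : (σ → ℂ) → MvPolynomial σ ℂ}
    (hg : ∀ z ∈ Z, ∀ w ∈ Z, eval z (g w) = if z = w then 1 else 0)
    {b : Z → MvPolynomial σ ℂ} (hb : ∑ z : Z, aeval F (b z) * g z = 0) : b = 0 := by
  choose φ hφ hφF using fun z : Z => exists_local_inverse (hZ z z.2) (hdet z z.2)
  -- On the branch `φ z` of the local inverse, `aeval F (b w)` takes the value `b w` at `y`. The
  -- relation thus becomes a linear system with matrix `M y`, which tends to the identity as `y →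
  -- 0`, so every `b w` vanishes near the origin.
  let M : (σ → ℂ) → Matrix Z Z ℂ := fun y => Matrix.of fun z w => eval (φ z y) (g w)
  have hM : Filter.Tendsto M (𝓝 0) (𝓝 1) := by
    refine tendsto_pi_nhds.2 fun z => tendsto_pi_nhds.2 fun w => ?_
    have h1 : (1 : Matrix Z Z ℂ) z w = eval (z : σ → ℂ) (g w) := by
      rw [hg z z.2 w w.2, Matrix.one_apply]
      simp only [Subtype.ext_iff]
    rw [h1]
    exact ((continuous_eval (g w)).tendsto _).comp (hφ z)
  have hMdet : ∀ᶠ y in 𝓝 0, (M y).det ≠ 0 := by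
    have h1 : Filter.Tendsto (fun y => (M y).det) (𝓝 0) (𝓝 (1 : Matrix Z Z ℂ).det) :=
      (continuous_id.matrix_det.tendsto _).comp hM
    exact h1.eventually_ne (by simp)
  funext z
  refine eq_zero_of_eventually_eval_eq_zero ?_
  filter_upwards [hMdet, Filter.eventually_all.2 hφF] with y hy hyF
  have h2 : (M y).mulVec (fun w => eval y (b w)) = 0 := by
    funext w
    have h3 : ∀ p : MvPolynomial σ ℂ, eval (φ w y) (aeval F p) = eval y p := fun p => by
      have : (aeval (φ w y)).comp (aeval F) = (aeval y : MvPolynomial σ ℂ →ₐ[ℂ] ℂ) := by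
        ext i
        simpa using hyF w i
      exact DFunLike.congr_fun this p
    have h4 := congrArg (eval (φ w y)) hb
    simp only [map_sum, map_mul, h3, map_zero] at h4
    simp only [Matrix.mulVec, dotProduct, M, Matrix.of_apply, Pi.zero_apply]
    rw [← h4]
    exact Finset.sum_congr rfl fun v _ => mul_comm _ _
  exact congrFun (Matrix.eq_zero_of_mulVec_eq_zero hy h2) z

/-- By independence over `ℂ[F]`, the map `b ↦ ∑ b_z(F) g_z` is injective on families of degree at
most `s`; `e` is the largest degree of an interpolation polynomial. -/
theorem card_mul_choose_le [Fintype σ] [DecidableEq σ] [DecidableEq (σ → ℂ)]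
    {F : σ → MvPolynomial σ ℂ} {m : ℕ} (hF : ∀ i, (F i).totalDegree ≤ m) {Z : Finset (σ → ℂ)}
    (hZ : ∀ z ∈ Z, z ∈ affineLocus F) (hdet : ∀ z ∈ Z, (jacobiMatrix F z).det ≠ 0) :
    ∃ e, ∀ s, Z.card * (s + Fintype.card σ).choose (Fintype.card σ) ≤
      (m * s + e + Fintype.card σ).choose (Fintype.card σ) := by
  obtain ⟨g, hg⟩ := exists_interpolation Z
  refine ⟨Z.sup fun z => (g z).totalDegree, fun s => ?_⟩
  set e := Z.sup fun z => (g z).totalDegree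
  let Φ : (Z → restrictTotalDegree σ ℂ s) →ₗ[ℂ] MvPolynomial σ ℂ :=
    ∑ z : Z, (LinearMap.mulRight ℂ (g z)) ∘ₗ (aeval F : MvPolynomial σ ℂ →ₐ[ℂ] _).toLinearMap ∘ₗ
      (restrictTotalDegree σ ℂ s).subtype ∘ₗ LinearMap.proj z
  have hΦ : ∀ b, Φ b = ∑ z : Z, aeval F (b z : MvPolynomial σ ℂ) * g z := fun b => by
    simp [Φ, LinearMap.sum_apply]
  have hmem : ∀ b, Φ b ∈ restrictTotalDegree σ ℂ (m * s + e) := fun b => by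
    rw [hΦ]
    refine Submodule.sum_mem _ fun z _ => ?_
    rw [mem_restrictTotalDegree]
    have h1 := degreeLEIn_le_restrictTotalDegree hF s ⟨(b z : MvPolynomial σ ℂ), (b z).2, rfl⟩
    rw [mem_restrictTotalDegree] at h1
    exact (totalDegree_mul _ _).trans
      (add_le_add h1 (Finset.le_sup (f := fun z => (g z).totalDegree) z.2))
  have hinj : Function.Injective (Φ.codRestrict _ hmem) := by
    rw [LinearMap.injective_codRestrict_iff, ← LinearMap.ker_eq_bot, LinearMap.ker_eq_bot']
    intro b hb
    rw [hΦ] at hb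
    have := eq_zero_of_sum_aeval_mul_eq_zero hZ hdet hg (b := fun z => (b z).1) hb
    funext z
    exact Subtype.ext (congrFun this z)
  have := LinearMap.finrank_le_finrank_of_injective hinj
  rw [Module.finrank_pi_fintype] at this
  simpa [finrank_restrictTotalDegree] using this

end Counting

/-! ### Upper bound for `m ^ n` by Nakayama, and Bézout's theorem -/

section Bezout

variable {σ : Type*}

theorem fg_top_over_range [Fintype σ] {F : σ → MvPolynomial σ ℂ} {E : ℕ} {d : ℕ → ℕ}
    (hE : ∀ D, restrictTotalDegree σ ℂ D ≤ degreeLEIn F (d D) * restrictTotalDegree σ ℂ E) :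
    (⊤ : Submodule (aeval F : MvPolynomial σ ℂ →ₐ[ℂ] _).range (MvPolynomial σ ℂ)).FG := by
  let B : Subalgebra ℂ (MvPolynomial σ ℂ) := (aeval F : MvPolynomial σ ℂ →ₐ[ℂ] _).range
  obtain ⟨S, hS⟩ := (inferInstance : Module.Finite ℂ (restrictTotalDegree σ ℂ E)).fg_top
  let T : Submodule B (MvPolynomial σ ℂ) :=
    Submodule.span B (S.map ⟨Subtype.val, Subtype.val_injective⟩ : Finset (MvPolynomial σ ℂ))
  refine ⟨S.map ⟨Subtype.val, Subtype.val_injective⟩, top_unique fun p _ => ?_⟩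
  have hsub : ∀ w : restrictTotalDegree σ ℂ E, (w : MvPolynomial σ ℂ) ∈ T := fun w => by
    have hw : w ∈ Submodule.span ℂ (S : Set (restrictTotalDegree σ ℂ E)) := hS ▸ trivial
    induction hw using Submodule.span_induction with
    | mem w hw => exact Submodule.subset_span (by simpa using hw)
    | zero => exact Submodule.zero_mem _
    | add x y _ _ hx hy => exact Submodule.add_mem _ hx hy
    | smul c x _ hx =>
      have := Submodule.smul_mem _ (algebraMap ℂ B c) hx
      rwa [algebraMap_smul] at this
  have hle : degreeLEIn F (d p.totalDegree) * restrictTotalDegree σ ℂ E ≤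
      T.restrictScalars ℂ := by
    rw [Submodule.mul_le]
    rintro _ ⟨b, -, rfl⟩ w hw
    exact Submodule.smul_mem T (⟨aeval F b, b, rfl⟩ : B) (hsub ⟨w, hw⟩)
  exact hle (hE _ ((mem_restrictTotalDegree σ _ p).2 le_rfl))

/-- Subtracting from `p` its interpolant leaves a polynomial vanishing on `Z`, hence in the ideal of
the `F i`. So the `g z` generate the ring modulo that ideal, and Nakayama's lemma over `B` supplies
`r`. -/
theorem exists_smul_mem_span_interpolation [Fintype σ] [DecidableEq (σ → ℂ)] {B : Type*}
    [CommRing B] [Algebra B (MvPolynomial σ ℂ)] {F : σ → MvPolynomial σ ℂ} {F' : σ → B}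
    (hF' : ∀ i, algebraMap B (MvPolynomial σ ℂ) (F' i) = F i) {c : ℂ → B}
    (hc : ∀ a, algebraMap B (MvPolynomial σ ℂ) (c a) = C a)
    (hfg : (⊤ : Submodule B (MvPolynomial σ ℂ)).FG) {Z : Finset (σ → ℂ)}
    (hI : ∀ h : MvPolynomial σ ℂ, (∀ z ∈ Z, eval z h = 0) → h ∈ Ideal.span (Set.range F))
    {g : (σ → ℂ) → MvPolynomial σ ℂ}
    (hg : ∀ z ∈ Z, ∀ w ∈ Z, eval z (g w) = if z = w then 1 else 0) :
    ∃ r : B, r - 1 ∈ Ideal.span (Set.range F') ∧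
      ∀ p, r • p ∈ Submodule.span B (Set.range fun z : Z => g z) := by
  have hle : (⊤ : Submodule B (MvPolynomial σ ℂ)) ≤
      Submodule.span B (Set.range fun z : Z => g z) ⊔ Ideal.span (Set.range F') • ⊤ := by
    intro p _
    have h1 : p - ∑ z : Z, c (eval z p) • g z ∈ Ideal.span (Set.range F) := by
      refine hI _ fun z hz => ?_
      rw [map_sub, map_sum, Finset.sum_eq_single ⟨z, hz⟩]
      · simp [hg z hz z hz, Algebra.smul_def, hc]
      · intro w _ hw
        rw [Algebra.smul_def, map_mul, hg z hz w w.2, if_neg fun h => hw (Subtype.ext h.symm),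
          mul_zero]
      · simp
    obtain ⟨a, ha⟩ := Ideal.mem_span_range_iff_exists_fun.1 h1
    rw [← add_sub_cancel (∑ z : Z, c (eval z p) • g z) p, ← ha]
    refine Submodule.add_mem_sup (Submodule.sum_mem _ fun z _ =>
      Submodule.smul_mem _ _ (Submodule.subset_span ⟨z, rfl⟩)) (Submodule.sum_mem _ fun i _ => ?_)
    rw [mul_comm, ← hF', ← Algebra.smul_def]
    exact Submodule.smul_mem_smul (Ideal.subset_span ⟨i, rfl⟩) trivial
  obtain ⟨r, hr, hrN⟩ := Submodule.exists_sub_one_mem_and_smul_le_of_fg_of_le_sup hfg le_top hle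
  exact ⟨r, hr, fun p => hrN ⟨p, trivial, rfl⟩⟩

/-- A nonzero polynomial multiplies every polynomial into the space spanned, over the polynomials
in the `F i`, by interpolation polynomials of the zeros of the `F i`. -/
theorem exists_mul_mem [Fintype σ] [DecidableEq (σ → ℂ)]
    {F : σ → MvPolynomial σ ℂ} {E : ℕ} {d : ℕ → ℕ}
    (hE : ∀ D, restrictTotalDegree σ ℂ D ≤ degreeLEIn F (d D) * restrictTotalDegree σ ℂ E)
    {Z : Finset (σ → ℂ)} (hZ : ∀ z, z ∈ Z ↔ z ∈ affineLocus F) (hne : Z.Nonempty)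
    (hI : ∀ h : MvPolynomial σ ℂ, (∀ z ∈ Z, eval z h = 0) → h ∈ Ideal.span (Set.range F))
    {g : (σ → ℂ) → MvPolynomial σ ℂ}
    (hg : ∀ z ∈ Z, ∀ w ∈ Z, eval z (g w) = if z = w then 1 else 0) :
    ∃ r : MvPolynomial σ ℂ, r ≠ 0 ∧ ∀ p : MvPolynomial σ ℂ, ∃ b : Z → MvPolynomial σ ℂ,
      r * p = ∑ z : Z, aeval F (b z) * g z := by
  let B : Subalgebra ℂ (MvPolynomial σ ℂ) := (aeval F : MvPolynomial σ ℂ →ₐ[ℂ] _).range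
  let F' : σ → B := fun i => ⟨F i, X i, by simp⟩
  obtain ⟨r, hr, hrN⟩ := exists_smul_mem_span_interpolation (F' := F') (c := algebraMap ℂ B)
    (fun _ => rfl) (fun _ => rfl) (fg_top_over_range hE) hI hg
  refine ⟨r, ?_, fun p => ?_⟩
  · obtain ⟨z, hz⟩ := hne
    intro h0
    -- Evaluation at a zero `z` kills `r - 1`, so `r` takes the value 1 there and is not zero.
    have hker : Ideal.span (Set.range F') ≤ RingHom.ker ((aeval z : MvPolynomial σ ℂ →ₐ[ℂ] ℂ).comp B.val) := by
      rw [Ideal.span_le]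
      rintro _ ⟨i, rfl⟩
      simpa using (hZ z).1 hz i
    have := hker hr
    rw [RingHom.mem_ker, map_sub, map_one] at this
    simp [h0] at this
  · obtain ⟨c, hc⟩ := (Submodule.mem_span_range_iff_exists_fun B).1 (hrN p)
    choose b hb using fun z => (c z).2
    refine ⟨b, hc.symm.trans (Finset.sum_congr rfl fun z _ => ?_)⟩
    rw [Subalgebra.smul_def, smul_eq_mul]
    exact congrArg (· * _) (hb z).symm

/-- Multiplication by `r` embeds the polynomials of degree at most `D` into combinations of the `g
z`. It suffices to expand `r * w` for finitely many `w` spanning degree at most `E`; `c` bounds the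
degrees of the coefficients that occur. -/
theorem choose_le_card_mul_choose [Fintype σ] [DecidableEq (σ → ℂ)]
    {F : σ → MvPolynomial σ ℂ} {E : ℕ} {d : ℕ → ℕ}
    (hE : ∀ D, restrictTotalDegree σ ℂ D ≤ degreeLEIn F (d D) * restrictTotalDegree σ ℂ E)
    {Z : Finset (σ → ℂ)} (hZ : ∀ z, z ∈ Z ↔ z ∈ affineLocus F) (hne : Z.Nonempty)
    (hI : ∀ h : MvPolynomial σ ℂ, (∀ z ∈ Z, eval z h = 0) → h ∈ Ideal.span (Set.range F)) :
    ∃ c, ∀ D, (D + Fintype.card σ).choose (Fintype.card σ) ≤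
      Z.card * (d D + c + Fintype.card σ).choose (Fintype.card σ) := by
  obtain ⟨g, hg⟩ := exists_interpolation Z
  obtain ⟨r, hr0, hr⟩ := exists_mul_mem hE hZ hne hI hg
  choose b hb using hr
  obtain ⟨S, hS⟩ := (inferInstance : Module.Finite ℂ (restrictTotalDegree σ ℂ E)).fg_top
  refine ⟨S.sup fun w => Finset.univ.sup fun z : Z => (b w z).totalDegree, fun D => ?_⟩
  set c := S.sup fun w => Finset.univ.sup fun z : Z => (b w z).totalDegree
  let Φ : (Z → restrictTotalDegree σ ℂ (d D + c)) →ₗ[ℂ] MvPolynomial σ ℂ :=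
    ∑ z : Z, (LinearMap.mulRight ℂ (g z)) ∘ₗ (aeval F : MvPolynomial σ ℂ →ₐ[ℂ] _).toLinearMap ∘ₗ
      (restrictTotalDegree σ ℂ (d D + c)).subtype ∘ₗ LinearMap.proj z
  have hΦ : ∀ b, Φ b = ∑ z : Z, aeval F (b z : MvPolynomial σ ℂ) * g z := fun b => by
    simp [Φ, LinearMap.sum_apply]
  have hle : (restrictTotalDegree σ ℂ D).map (LinearMap.mulLeft ℂ r) ≤ LinearMap.range Φ := by
    rw [Submodule.map_le_iff_le_comap]
    refine (hE D).trans ?_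
    rw [Submodule.mul_le]
    rintro _ ⟨q, hq, rfl⟩ w hw
    have hq' : q.totalDegree ≤ d D := (mem_restrictTotalDegree σ _ q).1 hq
    lift w to restrictTotalDegree σ ℂ E using hw
    have hw : w ∈ Submodule.span ℂ (S : Set (restrictTotalDegree σ ℂ E)) := hS ▸ trivial
    induction hw using Submodule.span_induction with
    | mem w hw =>
      have hdeg : ∀ z : Z, q * b w z ∈ restrictTotalDegree σ ℂ (d D + c) := fun z => by
        rw [mem_restrictTotalDegree]
        refine (totalDegree_mul _ _).trans (add_le_add hq' ?_)
        exact (Finset.le_sup (f := fun z : Z => (b w z).totalDegree) (Finset.mem_univ z)).trans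
          (Finset.le_sup (f := fun w : restrictTotalDegree σ ℂ E =>
            Finset.univ.sup fun z : Z => (b w z).totalDegree) hw)
      refine ⟨fun z => ⟨q * b w z, hdeg z⟩, ?_⟩
      rw [hΦ, LinearMap.mulLeft_apply, AlgHom.toLinearMap_apply, mul_left_comm, hb,
        Finset.mul_sum]
      exact Finset.sum_congr rfl fun z _ => by rw [map_mul, mul_assoc]
    | zero => simp
    | add x y _ _ hx hy =>
      rw [Submodule.coe_add, mul_add]
      exact Submodule.add_mem _ hx hy
    | smul a x _ hx =>
      rw [Submodule.coe_smul, mul_smul_comm]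
      exact Submodule.smul_mem _ _ hx
  have hinj : Function.Injective (LinearMap.mulLeft ℂ r) := fun p q h => mul_left_cancel₀ hr0 h
  have h1 := Submodule.finrank_mono hle
  have h2 := LinearMap.finrank_range_le Φ
  rw [← (Submodule.equivMapOfInjective _ hinj _).finrank_eq, finrank_restrictTotalDegree] at h1
  rw [Module.finrank_pi_fintype] at h2
  refine h1.trans (h2.trans_eq ?_)
  simp [finrank_restrictTotalDegree]

theorem tendsto_choose_div_pow {m : ℕ} (hm : 0 < m) (a n : ℕ) :
    Filter.Tendsto (fun s : ℕ => ((m * s + a).choose n : ℝ) / (s : ℝ) ^ n) Filter.atTop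
      (𝓝 ((m : ℝ) ^ n / n.factorial)) := by
  have h0 : Filter.Tendsto (fun s : ℕ => m * s + a) Filter.atTop Filter.atTop :=
    Filter.tendsto_atTop_mono (fun s => show s ≤ _ by nlinarith) Filter.tendsto_id
  have h1 : Filter.Tendsto (fun s : ℕ => ((m * s + a : ℕ) : ℝ) / s) Filter.atTop (𝓝 m) := by
    have h2 : Filter.Tendsto (fun s : ℕ => (m : ℝ) + a / s) Filter.atTop (𝓝 (m + 0)) :=
      tendsto_const_nhds.add (tendsto_const_div_atTop_nhds_zero_nat (a : ℝ))
    rw [add_zero] at h2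
    refine h2.congr' ?_
    filter_upwards [Filter.eventually_gt_atTop 0] with s hs
    have : (s : ℝ) ≠ 0 := by positivity
    push_cast
    field_simp
  have h3 := (isEquivalent_choose n).comp_tendsto h0
  have h4 : Filter.Tendsto (fun s : ℕ => (((m * s + a : ℕ) : ℝ) / s) ^ n / n.factorial)
      Filter.atTop (𝓝 ((m : ℝ) ^ n / n.factorial)) := (h1.pow n).div_const _
  have h5 := h3.mul (Asymptotics.IsEquivalent.refl (u := fun s : ℕ => ((s : ℝ) ^ n)⁻¹)
    (l := Filter.atTop))
  refine (h5.symm.tendsto_nhds (h4.congr fun s => ?_)).congr fun s => ?_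
  · simp only [Pi.mul_apply, Function.comp_apply, div_pow]
    ring
  · simp only [Pi.mul_apply, Function.comp_apply, div_eq_mul_inv]

/-- **Bézout's theorem** in the nondegenerate case: polynomials `F i`, as many as variables, whose
leading forms of degree `m` have no common non-trivial zero and whose common zeros are all
nondegenerate, have exactly `m ^ n` common zeros. -/
theorem ncard_affineLocus [Fintype σ] [DecidableEq σ] {m : ℕ} (hm : 0 < m)
    {f F : σ → MvPolynomial σ ℂ} (hf : ∀ i, (f i).IsHomogeneous m)
    (hf0 : ∀ x : σ → ℂ, (∀ i, eval x (f i) = 0) → x = 0)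
    (hF : ∀ i, (F i - f i).totalDegree < m)
    (hne : (affineLocus F).Nonempty)
    (hdet : ∀ z ∈ affineLocus F, (jacobiMatrix F z).det ≠ 0) :
    (affineLocus F).ncard = m ^ Fintype.card σ := by
  classical
  obtain ⟨E, hE⟩ := exists_restrictTotalDegree_le hm hf hf0 hF
  have hfin := finite_affineLocus hE
  have hdeg : ∀ i, (F i).totalDegree ≤ m := fun i => by
    have h1 := totalDegree_add (F i - f i) (f i)
    rw [sub_add_cancel] at h1
    exact h1.trans (max_le (hF i).le (hf i).totalDegree_le)
  obtain ⟨e, he⟩ := card_mul_choose_le hdeg (Z := hfin.toFinset) (by simp)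
    fun z hz => hdet z (by simpa using hz)
  obtain ⟨c, hc⟩ := choose_le_card_mul_choose hE (Z := hfin.toFinset) (by simp)
    (by simpa using hne) fun h hh => mem_span_of_forall_eval_eq_zero hfin hdet (by simpa using hh)
  rw [Set.ncard_eq_toFinset_card _ hfin]
  set N := hfin.toFinset.card
  set n := Fintype.card σ
  have hlim : ∀ a, Filter.Tendsto (fun s : ℕ => (N : ℝ) * (((1 * s + a).choose n : ℝ) /
      (s : ℝ) ^ n)) Filter.atTop (𝓝 (N * (((1 : ℕ) : ℝ) ^ n / n.factorial))) := fun a =>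
    (tendsto_choose_div_pow one_pos a n).const_mul _
  have h1 := le_of_tendsto_of_tendsto' (hlim n) (tendsto_choose_div_pow hm (e + n) n) fun s => by
    rw [← mul_div_assoc]
    gcongr
    rw [one_mul, ← add_assoc]
    exact_mod_cast he s
  -- The estimate is used only for `D = m * s`, where `D / m` is exactly `s`.
  have h2 := le_of_tendsto_of_tendsto' (tendsto_choose_div_pow hm n n) (hlim (c + n)) fun s => by
    rw [← mul_div_assoc]
    gcongr
    have := hc (m * s)
    rw [Nat.mul_div_cancel_left _ hm] at this
    rw [one_mul, ← add_assoc]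
    exact_mod_cast this
  have hpos : (0 : ℝ) < n.factorial := by positivity
  rw [Nat.cast_one, one_pow, mul_one_div] at h1 h2
  have h3 := (div_le_div_iff_of_pos_right hpos).1 h1
  have h4 := (div_le_div_iff_of_pos_right hpos).1 h2
  exact_mod_cast le_antisymm h3 h4

end Bezout

/-! ### Nondegenerate potentials and the count through V'(d) = d -/

section Nondegenerate

variable {n k : ℕ}

/-- The Hessian matrix `V''(d)`. -/
def hess (V : MvPolynomial (Fin n) ℂ) (d : Fin n → ℂ) : Matrix (Fin n) (Fin n) ℂ :=
  jacobiMatrix (fun i => pderiv i V) d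

/-- All solutions `d ≠ 0` of `V'(d) = γ d` are nondegenerate. -/
def IsNondegenerate (V : MvPolynomial (Fin n) ℂ) : Prop :=
  ∀ d : Fin n → ℂ, d ≠ 0 → ∀ γ : ℂ, grad V d = γ • d → (hess V d - γ • 1).det ≠ 0

theorem eval_smul_of_isHomogeneous {m : ℕ} {p : MvPolynomial (Fin n) ℂ} (hp : p.IsHomogeneous m)
    (c : ℂ) (d : Fin n → ℂ) : eval (c • d) p = c ^ m * eval d p := by
  simp only [Pi.smul_apply, smul_eq_mul, eval_eq, Finset.mul_sum]
  refine Finset.sum_congr rfl fun s hs => ?_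
  have hdeg : ∑ i ∈ s.support, s i = m := (hp.degree_eq_sum_deg_support hs).symm
  simp only [mul_pow, Finset.prod_mul_distrib, Finset.prod_pow_eq_pow_sum, hdeg]
  ring

theorem hess_smul {V : MvPolynomial (Fin n) ℂ} (hV : V.IsHomogeneous k) (c : ℂ)
    (d : Fin n → ℂ) : hess V (c • d) = c ^ (k - 2) • hess V d := by
  ext i j
  exact eval_smul_of_isHomogeneous hV.pderiv.pderiv c d

theorem hess_mulVec_self {V : MvPolynomial (Fin n) ℂ} (hV : V.IsHomogeneous k)
    (d : Fin n → ℂ) : (hess V d).mulVec d = ((k - 1 : ℕ) : ℂ) • grad V d := by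
  funext i
  have h := congrArg (eval d) ((hV.pderiv (i := i)).sum_X_mul_pderiv)
  simp only [map_sum, map_mul, eval_X, nsmul_eq_mul, map_natCast] at h
  simp only [Pi.smul_apply, smul_eq_mul, grad, ← h, Matrix.mulVec, dotProduct, hess, jacobiMatrix,
    Matrix.of_apply]
  exact Finset.sum_congr rfl fun j _ => mul_comm _ _

/-- Euler's identity for the partial derivatives, which have degree `k - 1`, gives V''(d)d =
(k-1)V'(d). -/
theorem hess_sub_mulVec_self (hk : 2 < k) {V : MvPolynomial (Fin n) ℂ} (hV : V.IsHomogeneous k)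
    {d : Fin n → ℂ} {γ : ℂ} (h : grad V d = γ • d) :
    (hess V d - γ • 1).mulVec d = (((k - 2 : ℕ) : ℂ) * γ) • d := by
  obtain ⟨k, rfl⟩ : ∃ l, k = l + 2 := ⟨k - 2, by omega⟩
  rw [Matrix.sub_mulVec, hess_mulVec_self hV, h, Matrix.smul_mulVec, Matrix.one_mulVec, smul_smul,
    ← sub_smul]
  congr 1
  rw [show k + 2 - 1 = k + 1 by omega, Nat.add_sub_cancel]
  push_cast
  ring

/-- A zero `d` of the gradient is the case γ = 0, in which `d` itself lies in the kernel of the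
Hessian. -/
theorem IsNondegenerate.grad_ne_zero (hk : 2 < k) {V : MvPolynomial (Fin n) ℂ}
    (hV : V.IsHomogeneous k) (h : IsNondegenerate V) {d : Fin n → ℂ} (hd : d ≠ 0) :
    grad V d ≠ 0 := fun h0 => by
  have h1 : grad V d = (0 : ℂ) • d := by rw [h0, zero_smul]
  have h2 := hess_sub_mulVec_self hk hV h1
  rw [mul_zero, zero_smul ℂ d] at h2
  exact h d hd 0 h1 (Matrix.exists_mulVec_eq_zero_iff.1 ⟨d, hd, h2⟩)

/-- The polynomials whose common zeros are the solutions of `V'(d) = d`. -/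
def fixedEq (V : MvPolynomial (Fin n) ℂ) (i : Fin n) : MvPolynomial (Fin n) ℂ :=
  pderiv i V - X i

theorem mem_affineLocus_fixedEq {V : MvPolynomial (Fin n) ℂ} {d : Fin n → ℂ} :
    d ∈ affineLocus (fixedEq V) ↔ grad V d = d := by
  simp [affineLocus, fixedEq, grad, funext_iff, sub_eq_zero]

theorem jacobiMatrix_fixedEq (V : MvPolynomial (Fin n) ℂ) (d : Fin n → ℂ) :
    jacobiMatrix (fixedEq V) d = hess V d - (1 : ℂ) • 1 := by
  ext i j
  simp [jacobiMatrix, fixedEq, hess, pderiv_X, Matrix.one_apply, Pi.single_apply]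

theorem totalDegree_fixedEq_sub_lt (hk : 2 < k) (V : MvPolynomial (Fin n) ℂ) (i : Fin n) :
    (fixedEq V i - pderiv i V).totalDegree < k - 1 := by
  rw [fixedEq, sub_sub_cancel_left, totalDegree_neg, totalDegree_X]
  omega

/-- Finiteness requires only that V' have no nontrivial zero. It is therefore available from
properness alone, before simplicity has been interpreted. -/
theorem finite_grad_eq_self (hk : 2 < k) {V : MvPolynomial (Fin n) ℂ} (hV : V.IsHomogeneous k)
    (h : ∀ d : Fin n → ℂ, d ≠ 0 → grad V d ≠ 0) : {d | grad V d = d}.Finite := by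
  obtain ⟨E, hE⟩ := exists_restrictTotalDegree_le (m := k - 1) (by omega)
    (fun i : Fin n => hV.pderiv (i := i))
    (fun x hx => by_contra fun hx0 => h x hx0 (funext hx)) (totalDegree_fixedEq_sub_lt hk V)
  refine (finite_affineLocus hE).subset fun d hd => ?_
  exact mem_affineLocus_fixedEq.2 hd

theorem ncard_grad_eq_self (hk : 2 < k) {V : MvPolynomial (Fin n) ℂ} (hV : V.IsHomogeneous k)
    (h : IsNondegenerate V) : {d | grad V d = d}.ncard = (k - 1) ^ n := by
  have hset : {d | grad V d = d} = affineLocus (fixedEq V) :=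
    Set.ext fun d => mem_affineLocus_fixedEq.symm
  rw [hset, ncard_affineLocus (m := k - 1) (by omega) (fun i : Fin n => hV.pderiv (i := i))
    (fun x hx => by_contra fun hx0 => h.grad_ne_zero hk hV hx0 (funext hx))
    (totalDegree_fixedEq_sub_lt hk V), Fintype.card_fin]
  · refine ⟨0, mem_affineLocus_fixedEq.2 ?_⟩
    have := grad_smul hV 0 (0 : Fin n → ℂ)
    rwa [zero_pow (by omega), zero_smul, zero_smul] at this
  · intro z hz
    rw [jacobiMatrix_fixedEq]
    rcases eq_or_ne z 0 with rfl | hz0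
    · have h0 : hess V 0 = 0 := by
        have := hess_smul hV 0 (0 : Fin n → ℂ)
        rwa [zero_pow (by omega), zero_smul, zero_smul] at this
      rw [h0, zero_sub, one_smul, Matrix.det_neg, Matrix.det_one]
      simp
    · exact h z hz0 1 (by rw [one_smul]; exact mem_affineLocus_fixedEq.1 hz)

/-- A Darboux point with `V'(d) ≠ 0` has a representative with `V'(d) = d`. -/
theorem exists_mk_eq_of_mem_properDarbouxPoints (hk : 2 < k) {V : MvPolynomial (Fin n) ℂ}
    (hV : V.IsHomogeneous k) {p : ℙ ℂ (Fin n → ℂ)} (hp : p ∈ properDarbouxPoints V) :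
    ∃ (d : Fin n → ℂ) (hd : d ≠ 0), grad V d = d ∧ Projectivization.mk ℂ d hd = p := by
  obtain ⟨⟨γ, hγ⟩, hne⟩ := hp
  have hγ0 : γ ≠ 0 := by
    rintro rfl
    exact hne (by rw [hγ, zero_smul])
  -- Scaling `d` by `c` multiplies γ by `c ^ (k - 2)`, so this root normalises γ to 1.
  obtain ⟨c, hc⟩ := IsAlgClosed.exists_pow_nat_eq γ⁻¹ (n := k - 2) (by omega)
  have hc0 : c ≠ 0 := by
    rintro rfl
    rw [zero_pow (by omega)] at hc
    exact inv_ne_zero hγ0 hc.symm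
  refine ⟨c • p.rep, smul_ne_zero hc0 p.rep_nonzero, ?_, ?_⟩
  · rw [grad_smul hV, hγ, smul_smul, show k - 1 = k - 2 + 1 by omega, pow_succ, hc]
    congr 1
    field_simp
  · conv_rhs => rw [← p.mk_rep]
    rw [Projectivization.mk_eq_mk_iff']
    exact ⟨c, rfl⟩

theorem finite_properDarbouxPoints (hk : 2 < k) {V : MvPolynomial (Fin n) ℂ}
    (hV : V.IsHomogeneous k) (h : ∀ d : Fin n → ℂ, d ≠ 0 → grad V d ≠ 0) :
    (properDarbouxPoints V).Finite := by
  choose! d hd hgrad hmk using fun p hp =>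
    exists_mk_eq_of_mem_properDarbouxPoints hk hV (p := p) hp
  refine Set.Finite.of_injOn (f := d) (fun p hp => hgrad p hp) (fun p hp q hq hpq => ?_)
    (finite_grad_eq_self hk hV h)
  rw [← hmk p hp, ← hmk q hq]
  simp only [hpq]

theorem ncard_pow_eq_one {m : ℕ} (hm : m ≠ 0) : {ζ : ℂ | ζ ^ m = 1}.ncard = m := by
  have h := (Complex.isPrimitiveRoot_exp m hm).card_nthRootsFinset
  rw [← Set.ncard_coe_finset] at h
  convert! h using 2
  ext ζ
  simp [Polynomial.mem_nthRootsFinset (Nat.pos_of_ne_zero hm)]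

/-- The nonzero solutions of `V'(d) = d` on the line of a given Darboux point form a torsor under
the roots of unity of order `k - 2`. -/
theorem ncard_properDarbouxPoints_mul (hk : 2 < k) {V : MvPolynomial (Fin n) ℂ}
    (hV : V.IsHomogeneous k) :
    (properDarbouxPoints V).ncard * (k - 2) = {d | grad V d = d ∧ d ≠ 0}.ncard := by
  choose! d hd hgrad hmk using fun p hp =>
    exists_mk_eq_of_mem_properDarbouxPoints hk hV (p := p) hp
  have hpow : ∀ c : ℂ, c ^ (k - 1) = c ^ (k - 2) * c := fun c => by
    rw [← pow_succ]; congr 1; omega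
  rw [← ncard_pow_eq_one (m := k - 2) (by omega), ← Set.ncard_prod]
  refine Set.ncard_congr (fun x _ => x.2 • d x.1) ?_ ?_ ?_
  · rintro ⟨p, ζ⟩ ⟨hp, hζ⟩
    have hζ' : ζ ^ (k - 2) = 1 := hζ
    have hζ0 : ζ ≠ 0 := by
      rintro rfl
      rw [zero_pow (by omega)] at hζ'
      exact zero_ne_one hζ'
    refine ⟨?_, smul_ne_zero hζ0 (hd p hp)⟩
    rw [grad_smul hV, hgrad p hp, hpow, hζ', one_mul]
  · rintro ⟨p, ζ⟩ ⟨q, η⟩ ⟨hp, hζ⟩ ⟨hq, hη⟩ heq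
    have hη' : η ^ (k - 2) = 1 := hη
    have hζ' : ζ ^ (k - 2) = 1 := hζ
    have hη0 : η ≠ 0 := by
      rintro rfl
      rw [zero_pow (by omega)] at hη'
      exact zero_ne_one hη'
    simp only at heq hp hq
    have hpq : p = q := by
      rw [← hmk p hp, ← hmk q hq]
      refine ((Projectivization.mk_eq_mk_iff' ℂ _ _ _ _).2 ⟨η⁻¹ * ζ, ?_⟩).symm
      rw [mul_smul, heq, smul_smul, inv_mul_cancel₀ hη0, one_smul]
    subst hpq
    rw [smul_left_injective ℂ (hd p hp) heq]
  · rintro v ⟨hv, hv0⟩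
    have hp : Projectivization.mk ℂ v hv0 ∈ properDarbouxPoints V :=
      (mk_mem_properDarbouxPoints_iff hk hV v hv0).2 ⟨⟨1, by rw [hv, one_smul]⟩, by rwa [hv]⟩
    obtain ⟨a, ha⟩ := (Projectivization.mk_eq_mk_iff' ℂ _ _ hv0 (hd _ hp)).1 (hmk _ hp).symm
    refine ⟨(Projectivization.mk ℂ v hv0, a), ⟨hp, ?_⟩, ha⟩
    have ha0 : a ≠ 0 := by
      rintro rfl
      exact hv0 (by rw [← ha, zero_smul])
    rw [← ha, grad_smul hV, hgrad _ hp] at hv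
    have h1 := smul_left_injective ℂ (hd _ hp) hv
    rw [hpow] at h1
    exact mul_right_cancel₀ ha0 (h1.trans (one_mul a).symm)

theorem ncard_properDarbouxPoints (hk : 2 < k) {V : MvPolynomial (Fin n) ℂ}
    (hV : V.IsHomogeneous k) (h : IsNondegenerate V) :
    ((properDarbouxPoints V).ncard : ℚ) = D n k := by
  have hfin := finite_grad_eq_self hk hV fun d => h.grad_ne_zero hk hV
  have h0 : (0 : Fin n → ℂ) ∈ {d | grad V d = d} := by
    have := grad_smul hV 0 (0 : Fin n → ℂ)
    rwa [zero_pow (by omega), zero_smul, zero_smul] at this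
  have h1 := ncard_properDarbouxPoints_mul hk hV
  have h2 := Set.ncard_sdiff_singleton_add_one h0 hfin
  rw [ncard_grad_eq_self hk hV h, show {d | grad V d = d} \ {0} =
    {d | grad V d = d ∧ d ≠ 0} from rfl, ← h1] at h2
  obtain ⟨k, rfl⟩ : ∃ l, k = l + 2 := ⟨k - 2, by omega⟩
  rw [show k + 2 - 1 = k + 1 by omega, Nat.add_sub_cancel] at h2
  have hk0 : (k : ℚ) ≠ 0 := by
    have : k ≠ 0 := by omega
    exact_mod_cast this
  have h3 : ((properDarbouxPoints V).ncard : ℚ) * k + 1 = ((k : ℚ) + 1) ^ n := by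
    exact_mod_cast h2
  rw [D]
  push_cast
  rw [show (k : ℚ) + 2 - 2 = k by ring, show (k : ℚ) + 2 - 1 = k + 1 by ring, eq_div_iff hk0, ← h3]
  ring

end Nondegenerate

/-! ### Affine charts: genericity is nondegeneracy -/

section Chart

variable {n k : ℕ}

/-- The vector with `i`-th coordinate `1` and given other coordinates. -/
def unchart (i : Fin n) (x : {j : Fin n // j ≠ i} → ℂ) : Fin n → ℂ :=
  fun j => if h : j = i then 1 else x ⟨j, h⟩

theorem unchart_self (i : Fin n) (x : {j : Fin n // j ≠ i} → ℂ) : unchart i x i = 1 := by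
  simp [unchart]

theorem unchart_coe {i : Fin n} (x : {j : Fin n // j ≠ i} → ℂ) (j : {j : Fin n // j ≠ i}) :
    unchart i x j = x j := by
  simp [unchart, j.2]

theorem unchart_ne_zero (i : Fin n) (x : {j : Fin n // j ≠ i} → ℂ) : unchart i x ≠ 0 := fun h => by
  simpa [h] using unchart_self i x

theorem unchart_chart {i : Fin n} {p : ℙ ℂ (Fin n → ℂ)} (hi : p.rep i ≠ 0) :
    unchart i (chart i p) = (p.rep i)⁻¹ • p.rep := by
  funext j
  by_cases h : j = i
  · subst h
    simp [unchart_self, inv_mul_cancel₀ hi]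
  · simp [unchart, h, chart, div_eq_inv_mul]

theorem eval_dehomogenise (i : Fin n) (x : {j : Fin n // j ≠ i} → ℂ)
    (p : MvPolynomial (Fin n) ℂ) : eval x (dehomogenise i p) = eval (unchart i x) p := by
  have : (aeval x).comp (dehomogenise i) =
      (aeval (unchart i x) : MvPolynomial (Fin n) ℂ →ₐ[ℂ] ℂ) := by
    ext j
    by_cases h : j = i <;> simp [dehomogenise, unchart, h]
  exact DFunLike.congr_fun this p

theorem pderiv_dehomogenise (i : Fin n) (j : {j : Fin n // j ≠ i}) (p : MvPolynomial (Fin n) ℂ) :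
    pderiv j (dehomogenise i p) = dehomogenise i (pderiv (j : Fin n) p) := by
  induction p using MvPolynomial.induction_on with
  | C a => simp [dehomogenise]
  | add p q hp hq => simp only [map_add, hp, hq]
  | mul_X p l hp =>
    have hl : pderiv j (dehomogenise i (X l)) = dehomogenise i (pderiv (j : Fin n) (X l)) := by
      by_cases h : l = i
      · subst h
        simp [dehomogenise, pderiv_X, j.2.symm]
      · simp only [dehomogenise, aeval_X, dif_neg h, pderiv_X, Pi.single_apply, Subtype.ext_iff]
        split_ifs <;> simp
    simp only [map_mul, pderiv_mul, map_add, hp, hl]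

theorem sub_eq_zero_iff_eq_smul {i : Fin n} {e w : Fin n → ℂ} (he : e i = 1) :
    (∀ a : {a : Fin n × Fin n // a.1 < a.2}, e a.1.1 * w a.1.2 - e a.1.2 * w a.1.1 = 0) ↔
      w = w i • e := by
  constructor
  · intro h
    funext j
    rcases lt_trichotomy i j with hij | rfl | hij
    · have := h ⟨(i, j), hij⟩
      simp only [he, one_mul] at this
      simpa [mul_comm] using sub_eq_zero.1 this
    · simp [he]
    · have := h ⟨(j, i), hij⟩
      simp only [he, one_mul] at this
      simpa [mul_comm] using (sub_eq_zero.1 this).symm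
  · rintro h ⟨⟨a, b⟩, -⟩
    have ha := congrFun h a
    have hb := congrFun h b
    simp only [Pi.smul_apply, smul_eq_mul] at ha hb
    simp only [ha, hb]
    ring

theorem mem_affineLocus_dehomogenise {V : MvPolynomial (Fin n) ℂ} {i : Fin n}
    {x : {j : Fin n // j ≠ i} → ℂ} :
    x ∈ affineLocus (fun a => dehomogenise i (darbouxEq V a)) ↔
      ∃ γ : ℂ, grad V (unchart i x) = γ • unchart i x := by
  have h : x ∈ affineLocus (fun a => dehomogenise i (darbouxEq V a)) ↔
      ∀ a : {a : Fin n × Fin n // a.1 < a.2}, unchart i x a.1.1 * grad V (unchart i x) a.1.2 -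
        unchart i x a.1.2 * grad V (unchart i x) a.1.1 = 0 := by
    simp only [affineLocus, Set.mem_ofPred, eval_dehomogenise, darbouxEq, map_sub, map_mul,
      eval_X, grad]
  rw [h, sub_eq_zero_iff_eq_smul (unchart_self i x)]
  refine ⟨fun h => ⟨_, h⟩, ?_⟩
  rintro ⟨γ, hγ⟩
  have := congrFun hγ i
  rw [Pi.smul_apply, unchart_self, smul_eq_mul, mul_one] at this
  rwa [this]

/-- The differential of q ∧ V'(q) at e is v ∧ V'(e) + e ∧ V''(e)v, and V'(e) = γe turns this into e
∧ (V''(e) - γ)v. The condition v_i = 0 describes directions within the chart. -/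
theorem jacobiMatrix_dehomogenise_mulVec {V : MvPolynomial (Fin n) ℂ} {i : Fin n}
    {x : {j : Fin n // j ≠ i} → ℂ} {γ : ℂ} (hγ : grad V (unchart i x) = γ • unchart i x)
    {v : Fin n → ℂ} (hv : v i = 0) (a : {a : Fin n × Fin n // a.1 < a.2}) :
    (jacobiMatrix (fun a => dehomogenise i (darbouxEq V a)) x).mulVec (fun j => v j) a =
      unchart i x a.1.1 * (hess V (unchart i x) - γ • 1).mulVec v a.1.2 -
        unchart i x a.1.2 * (hess V (unchart i x) - γ • 1).mulVec v a.1.1 := by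
  set e := unchart i x
  have hsum : ∀ f : Fin n → ℂ, ∑ j : {j : Fin n // j ≠ i}, f j * v j = ∑ j, f j * v j := fun f => by
    rw [Fintype.sum_eq_add_sum_subtype_ne (fun j => f j * v j) i, hv, mul_zero, zero_add]
  have hg : ∀ j, eval e (pderiv j V) = γ * e j := fun j => congrFun hγ j
  have hH : ∀ b, (hess V e - γ • 1).mulVec v b = ∑ j, eval e (pderiv j (pderiv b V)) * v j -
      γ * v b := fun b => by
    rw [Matrix.sub_mulVec, Matrix.smul_mulVec, Matrix.one_mulVec]
    rfl
  have hentry : ∀ j : {j : Fin n // j ≠ i},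
      jacobiMatrix (fun a => dehomogenise i (darbouxEq V a)) x a j =
        (Pi.single (M := fun _ => ℂ) a.1.1 1 (j : Fin n)) * (γ * e a.1.2) +
          e a.1.1 * eval e (pderiv (j : Fin n) (pderiv a.1.2 V)) -
        ((Pi.single (M := fun _ => ℂ) a.1.2 1 (j : Fin n)) * (γ * e a.1.1) +
          e a.1.2 * eval e (pderiv (j : Fin n) (pderiv a.1.1 V))) := fun j => by
    rw [jacobiMatrix, Matrix.of_apply, pderiv_dehomogenise, eval_dehomogenise, darbouxEq,
      map_sub, pderiv_mul, pderiv_mul, pderiv_X, pderiv_X]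
    simp only [map_sub, map_add, map_mul, eval_X]
    rw [hg, hg]
    have : ∀ b : Fin n, eval (unchart i x)
        (Pi.single (M := fun _ => MvPolynomial (Fin n) ℂ) (j : Fin n) 1 b) =
          Pi.single (M := fun _ => ℂ) b 1 (j : Fin n) := fun b => by
      simp only [Pi.single_apply, eq_comm (a := b)]
      split_ifs <;> simp
    rw [this, this]
  simp only [Matrix.mulVec, dotProduct] at hH ⊢
  simp only [hentry]
  rw [hsum fun j => (Pi.single (M := fun _ => ℂ) a.1.1 1 j) * (γ * e a.1.2) +
          e a.1.1 * eval e (pderiv j (pderiv a.1.2 V)) -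
        ((Pi.single (M := fun _ => ℂ) a.1.2 1 j) * (γ * e a.1.1) +
          e a.1.2 * eval e (pderiv j (pderiv a.1.1 V)))]
  rw [hH, hH]
  simp only [sub_mul, add_mul, Finset.sum_sub_distrib, Finset.sum_add_distrib, mul_assoc,
    ← Finset.mul_sum]
  simp [Pi.single_apply]
  ring

theorem rank_eq_card_iff {ι κ : Type*} [Fintype ι] [Finite κ] (A : Matrix κ ι ℂ) :
    A.rank = Fintype.card ι ↔ ∀ v, A.mulVec v = 0 → v = 0 := by
  have h := LinearMap.finrank_range_add_finrank_ker A.mulVecLin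
  rw [Module.finrank_fintype_fun_eq_card] at h
  rw [Matrix.rank, ← h, left_eq_add, Submodule.finrank_eq_zero, LinearMap.ker_eq_bot']
  rfl

/-- Nondegeneracy of a Darboux point in terms of the Jacobi matrix in an affine chart. -/
theorem rank_jacobiMatrix_iff (hk : 2 < k) {V : MvPolynomial (Fin n) ℂ} (hV : V.IsHomogeneous k)
    {i : Fin n} {x : {j : Fin n // j ≠ i} → ℂ} {γ : ℂ} (hγ0 : γ ≠ 0)
    (hγ : grad V (unchart i x) = γ • unchart i x) :
    (jacobiMatrix (fun a => dehomogenise i (darbouxEq V a)) x).rank =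
        Fintype.card {j : Fin n // j ≠ i} ↔
      (hess V (unchart i x) - γ • 1).det ≠ 0 := by
  set e := unchart i x
  have hei : e i = 1 := unchart_self i x
  have hself := hess_sub_mulVec_self hk hV hγ
  set M := hess V e - γ • 1
  set μ : ℂ := ((k - 2 : ℕ) : ℂ) * γ
  have hμ : μ ≠ 0 := mul_ne_zero (by exact_mod_cast (by omega : k - 2 ≠ 0)) hγ0
  rw [rank_eq_card_iff, Ne, ← Matrix.exists_mulVec_eq_zero_iff, not_exists]
  constructor
  · rintro h v ⟨hv0, hv⟩
    -- A kernel vector is moved into the chart along `e`. The correction is harmless because `e` is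
    -- an eigenvector, so it contributes a multiple of e ∧ e = 0.
    have hw : (v - v i • e) i = 0 := by simp [hei]
    have hker := h (fun j => (v - v i • e) j) (by
      funext a
      rw [jacobiMatrix_dehomogenise_mulVec hγ hw, Matrix.mulVec_sub, Matrix.mulVec_smul, hv, hself]
      simp only [Pi.sub_apply, Pi.smul_apply, Pi.zero_apply, smul_eq_mul]
      ring)
    have hve : v = v i • e := by
      funext j
      by_cases hj : j = i
      · subst hj; simp [hei]
      · exact sub_eq_zero.1 (congrFun hker ⟨j, hj⟩)
    rw [hve, Matrix.mulVec_smul, hself] at hv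
    have := congrFun hv i
    simp only [Pi.smul_apply, hei, smul_eq_mul, mul_one, Pi.zero_apply, mul_eq_zero, hμ,
      or_false] at this
    rw [this, zero_smul] at hve
    exact hv0 hve
  · intro h v hv
    let v' : Fin n → ℂ := fun j => if hj : j = i then 0 else v ⟨j, hj⟩
    have hv'i : v' i = 0 := by simp [v']
    have hv' : (fun j : {j : Fin n // j ≠ i} => v' j) = v := by
      funext j; simp [v', j.2]
    have hw : M.mulVec v' = M.mulVec v' i • e := by
      refine (sub_eq_zero_iff_eq_smul hei).1 fun a => ?_
      rw [← jacobiMatrix_dehomogenise_mulVec hγ hv'i, hv', hv]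
      rfl
    set c := M.mulVec v' i
    -- Here `M v' = c • e` and `M e = μ • e`, so this difference is in the kernel of `M`.
    have h0 : v' - (c / μ) • e = 0 := by
      by_contra hne
      refine h _ ⟨hne, ?_⟩
      rw [Matrix.mulVec_sub, Matrix.mulVec_smul, hself, hw, smul_smul, div_mul_cancel₀ _ hμ,
        sub_self]
    have hc := congrFun h0 i
    simp only [Pi.sub_apply, hv'i, Pi.smul_apply, hei, smul_eq_mul, mul_one, zero_sub,
      Pi.zero_apply, neg_eq_zero] at hc
    rw [hc, zero_smul, sub_zero] at h0
    rw [← hv', h0]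
    rfl

theorem algDim_singleton {σ : Type*} (x : σ → ℂ) : algDim {x} = 0 := by
  let _ : Field (MvPolynomial σ ℂ ⧸ (vanishingIdeal ℂ {x} : Ideal (MvPolynomial σ ℂ))) :=
    Ideal.Quotient.field _
  exact ringKrullDim_eq_zero_of_field _

theorem connectedComponentIn_eq_singleton {X : Type*} [TopologicalSpace X] [T1Space X]
    {s : Set X} (hs : s.Finite) {x : X} (hx : x ∈ s) : connectedComponentIn s x = {x} := by
  by_contra h
  have hnt : (connectedComponentIn s x).Nontrivial :=
    (Set.nontrivial_iff_ne_singleton (mem_connectedComponentIn hx)).2 h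
  exact isPreconnected_connectedComponentIn.infinite_of_nontrivial hnt
    (hs.subset (connectedComponentIn_subset s x))

/-- In a finite locus the connected component of a point is the point itself, of dimension 0. -/
theorem isSimplePoint_iff_of_finite {σ κ : Type*} [Fintype σ] {f : κ → MvPolynomial σ ℂ}
    (hf : (affineLocus f).Finite) {x : σ → ℂ} (hx : x ∈ affineLocus f) :
    IsSimplePoint f x ↔ (jacobiMatrix f x).rank = Fintype.card σ := by
  rw [IsSimplePoint, connectedComponentIn_eq_singleton hf hx, algDim_singleton, add_zero]
  simp only [hx, true_and]
  norm_cast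

theorem finite_affineLocus_dehomogenise (hk : 2 < k) {V : MvPolynomial (Fin n) ℂ}
    (hV : V.IsHomogeneous k) (h : ∀ d : Fin n → ℂ, d ≠ 0 → grad V d ≠ 0) (i : Fin n) :
    (affineLocus (fun a => dehomogenise i (darbouxEq V a))).Finite := by
  refine Set.Finite.of_injOn
    (f := fun x => Projectivization.mk ℂ (unchart i x) (unchart_ne_zero i x)) (fun x hx => ?_)
    (fun x _ y _ hxy => ?_) (finite_properDarbouxPoints hk hV h)
  · exact (mk_mem_properDarbouxPoints_iff hk hV _ _).2
      ⟨mem_affineLocus_dehomogenise.1 hx, h _ (unchart_ne_zero i x)⟩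
  · obtain ⟨a, ha⟩ := (Projectivization.mk_eq_mk_iff' ℂ _ _ _ _).1 hxy
    have h1 := congrFun ha i
    rw [Pi.smul_apply, unchart_self, unchart_self, smul_eq_mul, mul_one] at h1
    rw [h1, one_smul] at ha
    funext j
    rw [← unchart_coe x, ← unchart_coe y, ha]

theorem det_hess_smul_ne_zero_iff {V : MvPolynomial (Fin n) ℂ} (hV : V.IsHomogeneous k) {c : ℂ}
    (hc : c ≠ 0) (d : Fin n → ℂ) (γ : ℂ) :
    (hess V (c • d) - (c ^ (k - 2) * γ) • 1).det ≠ 0 ↔ (hess V d - γ • 1).det ≠ 0 := by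
  rw [hess_smul hV, mul_smul, ← smul_sub, Matrix.det_smul, mul_ne_zero_iff]
  simp [hc]

theorem grad_smul_of_grad_eq_smul (hk : 2 < k) {V : MvPolynomial (Fin n) ℂ}
    (hV : V.IsHomogeneous k) {d : Fin n → ℂ} {γ : ℂ} (h : grad V d = γ • d) (c : ℂ) :
    grad V (c • d) = (c ^ (k - 2) * γ) • (c • d) := by
  rw [grad_smul hV, h, smul_smul, smul_smul, show k - 1 = k - 2 + 1 by omega, pow_succ]
  congr 1
  ring

theorem isSimpleProjPoint_chart_iff (hk : 2 < k) {V : MvPolynomial (Fin n) ℂ}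
    (hV : V.IsHomogeneous k) (hprop : ∀ d : Fin n → ℂ, d ≠ 0 → grad V d ≠ 0)
    {p : ℙ ℂ (Fin n → ℂ)} {γ : ℂ} (hγ : grad V p.rep = γ • p.rep) {i : Fin n}
    (hi : p.rep i ≠ 0) :
    IsSimplePoint (fun a => dehomogenise i (darbouxEq V a)) (chart i p) ↔
      (hess V p.rep - γ • 1).det ≠ 0 := by
  have hγ0 : γ ≠ 0 := by
    rintro rfl
    exact hprop _ p.rep_nonzero (by rw [hγ, zero_smul])
  have hi' := inv_ne_zero hi
  have hγ' := grad_smul_of_grad_eq_smul hk hV hγ (p.rep i)⁻¹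
  rw [← unchart_chart hi] at hγ'
  rw [isSimplePoint_iff_of_finite (finite_affineLocus_dehomogenise hk hV hprop i)
    (mem_affineLocus_dehomogenise.2 ⟨_, hγ'⟩),
    rank_jacobiMatrix_iff hk hV (mul_ne_zero (pow_ne_zero _ hi') hγ0) hγ', unchart_chart hi,
    det_hess_smul_ne_zero_iff hV hi']

/-- In both directions properness comes first: it makes the charted loci finite, which excludes
simple points on positive-dimensional components and reduces simplicity to the determinant
condition. -/
theorem isGeneric_iff_isNondegenerate (hk : 2 < k) {V : MvPolynomial (Fin n) ℂ}
    (hV : V.IsHomogeneous k) : IsGeneric V ↔ IsNondegenerate V := by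
  constructor
  · intro h
    have hprop : ∀ d : Fin n → ℂ, d ≠ 0 → grad V d ≠ 0 := fun d hd h0 => by
      have hp : Projectivization.mk ℂ d hd ∈ darbouxPoints V :=
        (mk_mem_darbouxPoints_iff hk hV d hd).2 ⟨0, by rw [h0, zero_smul]⟩
      exact ((mk_mem_properDarbouxPoints_iff hk hV d hd).1 (h _ hp).1).2 h0
    intro d hd γ hγ
    obtain ⟨a, ha⟩ := Projectivization.exists_smul_eq_mk_rep ℂ d hd
    rw [Units.smul_def] at ha
    have hγ' := grad_smul_of_grad_eq_smul hk hV hγ (a : ℂ)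
    rw [ha] at hγ'
    obtain ⟨i, hi, hsimple⟩ := (h _ ⟨_, hγ'⟩).2
    rw [isSimpleProjPoint_chart_iff hk hV hprop hγ' hi, ← ha,
      det_hess_smul_ne_zero_iff hV a.ne_zero] at hsimple
    exact hsimple
  · intro h p hp
    have hprop : ∀ d : Fin n → ℂ, d ≠ 0 → grad V d ≠ 0 := fun d hd => h.grad_ne_zero hk hV hd
    refine ⟨⟨hp, hprop _ p.rep_nonzero⟩, ?_⟩
    obtain ⟨γ, hγ⟩ := hp
    obtain ⟨i, hi⟩ := Function.ne_iff.1 p.rep_nonzero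
    exact ⟨i, hi, (isSimpleProjPoint_chart_iff hk hV hprop hγ hi).2 (h _ p.rep_nonzero γ hγ)⟩

end Chart

/-! ### Non-emptiness and openness -/

section Generic

variable {n k : ℕ}

theorem pderiv_sum_X_pow (k : ℕ) (i : Fin n) :
    pderiv i (∑ j, X j ^ k : MvPolynomial (Fin n) ℂ) = C (k : ℂ) * X i ^ (k - 1) := by
  rw [map_sum, Finset.sum_eq_single i]
  · rw [pderiv_pow, pderiv_X_self, mul_one, map_natCast]
  · intro j _ hj
    rw [pderiv_pow, pderiv_X_of_ne hj, mul_zero]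
  · simp

/-- The matrix V''(d) - γ is diagonal. Its entry is (k-2)γ where d_j ≠ 0, because k d_j^(k-2) = γ
there, and -γ where d_j = 0. -/
theorem isNondegenerate_sum_X_pow (hk : 2 < k) :
    IsNondegenerate (∑ j, X j ^ k : MvPolynomial (Fin n) ℂ) := by
  intro d hd γ hγ
  have hpow : ∀ c : ℂ, c ^ (k - 1) = c ^ (k - 2) * c := fun c => by
    rw [← pow_succ]; congr 1; omega
  have hk0 : (k : ℂ) ≠ 0 := by exact_mod_cast (by omega : k ≠ 0)
  have hval : ∀ j, d j ≠ 0 → (k : ℂ) * d j ^ (k - 2) = γ := fun j hj => by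
    have := congrFun hγ j
    simp only [grad, pderiv_sum_X_pow, map_mul, eval_C, map_pow, eval_X, Pi.smul_apply,
      smul_eq_mul, hpow, ← mul_assoc] at this
    exact mul_right_cancel₀ hj this
  obtain ⟨i, hi⟩ := Function.ne_iff.1 hd
  have hγ0 : γ ≠ 0 := by
    rw [← hval i hi]
    exact mul_ne_zero hk0 (pow_ne_zero _ hi)
  have hdiag : hess (∑ j, X j ^ k : MvPolynomial (Fin n) ℂ) d - γ • 1 =
      Matrix.diagonal fun j => (k : ℂ) * (((k - 1 : ℕ) : ℂ) * d j ^ (k - 2)) - γ := by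
    ext a b
    rw [Matrix.sub_apply, Matrix.smul_apply, Matrix.diagonal_apply, Matrix.one_apply, hess,
      jacobiMatrix, Matrix.of_apply, pderiv_sum_X_pow, pderiv_C_mul, pderiv_pow]
    rcases eq_or_ne a b with rfl | hab
    · simp [show k - 1 - 1 = k - 2 by omega]
    · simp [pderiv_X_of_ne hab, hab]
  rw [hdiag, Matrix.det_diagonal, Finset.prod_ne_zero_iff]
  intro j _
  by_cases hj : d j = 0
  · rw [hj, zero_pow (by omega), mul_zero, mul_zero, zero_sub]
    exact neg_ne_zero.2 hγ0
  · rw [mul_left_comm, hval j hj, ← sub_one_mul]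
    refine mul_ne_zero ?_ hγ0
    rw [sub_ne_zero]
    exact_mod_cast (by omega : k - 1 ≠ 1)

/-- The values of a linear image of a homogeneous polynomial depend jointly continuously on the
polynomial and the point. -/
theorem continuous_eval_linearMap [TopologicalSpace (homogeneousSubmodule (Fin n) ℂ k)]
    [IsModuleTopology ℂ (homogeneousSubmodule (Fin n) ℂ k)]
    (L : MvPolynomial (Fin n) ℂ →ₗ[ℂ] MvPolynomial (Fin n) ℂ) :
    Continuous fun x : homogeneousSubmodule (Fin n) ℂ k × (Fin n → ℂ) =>
      eval x.2 (L (x.1 : MvPolynomial (Fin n) ℂ)) := by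
  classical
  let S : Finset (Fin n →₀ ℕ) := (Finset.univ : Finset (Fin n)).finsuppAntidiag k
  have hS : ∀ V : homogeneousSubmodule (Fin n) ℂ k,
      (V : MvPolynomial (Fin n) ℂ) = ∑ s ∈ S, coeff s (V : MvPolynomial (Fin n) ℂ) •
        monomial s (1 : ℂ) := fun V => by
    have hsub : (V : MvPolynomial (Fin n) ℂ).support ⊆ S := fun s hs => by
      have hV : (V : MvPolynomial (Fin n) ℂ).IsHomogeneous k := V.2
      rw [Finset.mem_finsuppAntidiag]
      refine ⟨?_, Finset.subset_univ _⟩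
      rw [hV.degree_eq_sum_deg_support hs]
      exact (Finset.sum_subset (Finset.subset_univ _) (by simp)).symm
    conv_lhs => rw [(V : MvPolynomial (Fin n) ℂ).as_sum]
    rw [Finset.sum_subset hsub fun s _ hs => by rw [notMem_support_iff.1 hs, monomial_zero]]
    simp [smul_monomial]
  have hcoeff : ∀ s, Continuous fun V : homogeneousSubmodule (Fin n) ℂ k =>
      coeff s (V : MvPolynomial (Fin n) ℂ) := fun s =>
    IsModuleTopology.continuous_of_linearMap
      ((lcoeff ℂ s).comp (homogeneousSubmodule (Fin n) ℂ k).subtype)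
  have heq : (fun x : homogeneousSubmodule (Fin n) ℂ k × (Fin n → ℂ) =>
      eval x.2 (L (x.1 : MvPolynomial (Fin n) ℂ))) = fun x => ∑ s ∈ S,
        coeff s (x.1 : MvPolynomial (Fin n) ℂ) * eval x.2 (L (monomial s 1)) := by
    funext x
    conv_lhs => rw [hS x.1]
    simp [map_sum]
  rw [heq]
  exact continuous_finsetSum _ fun s _ => ((hcoeff s).comp continuous_fst).mul
    ((continuous_eval _).comp continuous_snd)

/-- The squared Euclidean norm of `d`. -/
def sqNorm (d : Fin n → ℂ) : ℂ := ∑ j, star (d j) * d j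

/-- The Hermitian product of `d` and `V'(d)`. -/
def gradInner (V : MvPolynomial (Fin n) ℂ) (d : Fin n → ℂ) : ℂ := ∑ j, star (d j) * grad V d j

open scoped ComplexOrder in
theorem sqNorm_ne_zero {d : Fin n → ℂ} (hd : d ≠ 0) : sqNorm d ≠ 0 := by
  rw [sqNorm]
  exact fun h => hd (dotProduct_star_self_eq_zero.1 h)

/-- The parameter γ is eliminated: on a solution it must equal ⟨d, V'(d)⟩/|d|². Multiplying through
by |d|² avoids the division; it is not constantly 1, since the sphere is that of the sup norm.
Homogeneity reduces all d ≠ 0 to this compact set. -/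
theorem isNondegenerate_iff_forall_sphere (hk : 2 < k) {V : MvPolynomial (Fin n) ℂ}
    (hV : V.IsHomogeneous k) : IsNondegenerate V ↔ ∀ d ∈ Metric.sphere (0 : Fin n → ℂ) 1,
      sqNorm d • grad V d - gradInner V d • d ≠ 0 ∨
        (sqNorm d • hess V d - gradInner V d • 1).det ≠ 0 := by
  constructor
  · intro h d hd
    have hd0 : d ≠ 0 := by
      rintro rfl
      simp at hd
    have hq := sqNorm_ne_zero hd0
    by_cases h0 : sqNorm d • grad V d - gradInner V d • d = 0
    · right
      have h1 := h d hd0 ((sqNorm d)⁻¹ * gradInner V d) (by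
        rw [mul_smul, ← sub_eq_zero.1 h0, smul_smul, inv_mul_cancel₀ hq, one_smul])
      have h2 : sqNorm d • hess V d - gradInner V d • 1 =
          sqNorm d • (hess V d - ((sqNorm d)⁻¹ * gradInner V d) • 1) := by
        rw [smul_sub, smul_smul, mul_inv_cancel_left₀ hq]
      rw [h2, Matrix.det_smul]
      exact mul_ne_zero (pow_ne_zero _ hq) h1
    · exact Or.inl h0
  · intro h d hd γ hγ
    have hc : ((‖d‖⁻¹ : ℝ) : ℂ) ≠ 0 := by
      exact_mod_cast inv_ne_zero (norm_ne_zero_iff.2 hd)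
    have hγ' := grad_smul_of_grad_eq_smul hk hV hγ ((‖d‖⁻¹ : ℝ) : ℂ)
    rw [← det_hess_smul_ne_zero_iff hV hc]
    set e := ((‖d‖⁻¹ : ℝ) : ℂ) • d with he
    set δ := (((‖d‖⁻¹ : ℝ) : ℂ) ^ (k - 2) * γ)
    have hmem : e ∈ Metric.sphere (0 : Fin n → ℂ) 1 := by
      rw [mem_sphere_zero_iff_norm, he, norm_smul, Complex.norm_real, norm_inv, norm_norm,
        inv_mul_cancel₀ (norm_ne_zero_iff.2 hd)]
    have hinner : gradInner V e = sqNorm e * δ := by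
      rw [gradInner, sqNorm, hγ', Finset.sum_mul]
      exact Finset.sum_congr rfl fun j _ => by rw [Pi.smul_apply, smul_eq_mul]; ring
    have h1 := h e hmem
    rw [hinner, hγ', mul_smul _ δ e, sub_self, mul_smul _ δ (1 : Matrix _ _ ℂ), ← smul_sub, Matrix.det_smul] at h1
    rcases h1 with h1 | h1
    · exact absurd rfl h1
    · exact right_ne_zero_of_mul h1

theorem isOpen_genericPotentials (hk : 2 < k) :
    IsOpen[moduleTopology ℂ (homogeneousSubmodule (Fin n) ℂ k)] (genericPotentials n k) := by
  let _ : TopologicalSpace (homogeneousSubmodule (Fin n) ℂ k) := moduleTopology ℂ _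
  have _ : IsModuleTopology ℂ (homogeneousSubmodule (Fin n) ℂ k) := ⟨rfl⟩
  change IsOpen (genericPotentials n k)
  have hset : genericPotentials n k = {V : homogeneousSubmodule (Fin n) ℂ k |
      ∀ d ∈ Metric.sphere (0 : Fin n → ℂ) 1,
        sqNorm d • grad (V : MvPolynomial (Fin n) ℂ) d - gradInner V.1 d • d ≠ 0 ∨
          (sqNorm d • hess (V : MvPolynomial (Fin n) ℂ) d - gradInner V.1 d • 1).det ≠ 0} :=
    Set.ext fun V => (isGeneric_iff_isNondegenerate hk V.2).trans
      (isNondegenerate_iff_forall_sphere hk V.2)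
  have hgrad : Continuous fun x : homogeneousSubmodule (Fin n) ℂ k × (Fin n → ℂ) =>
      grad (x.1 : MvPolynomial (Fin n) ℂ) x.2 :=
    continuous_pi fun i => continuous_eval_linearMap (pderiv i).toLinearMap
  have hhess : Continuous fun x : homogeneousSubmodule (Fin n) ℂ k × (Fin n → ℂ) =>
      hess (x.1 : MvPolynomial (Fin n) ℂ) x.2 :=
    continuous_matrix fun i j =>
      continuous_eval_linearMap ((pderiv j).toLinearMap ∘ₗ (pderiv i).toLinearMap)
  have hcoord : ∀ j, Continuous fun x : homogeneousSubmodule (Fin n) ℂ k × (Fin n → ℂ) =>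
      x.2 j := fun j => (continuous_apply j).comp continuous_snd
  have hsq : Continuous fun x : homogeneousSubmodule (Fin n) ℂ k × (Fin n → ℂ) =>
      sqNorm x.2 := continuous_finsetSum _ fun j _ => (hcoord j).star.mul (hcoord j)
  have hinner : Continuous fun x : homogeneousSubmodule (Fin n) ℂ k × (Fin n → ℂ) =>
      gradInner (x.1 : MvPolynomial (Fin n) ℂ) x.2 := continuous_finsetSum _ fun j _ =>
    (hcoord j).star.mul ((continuous_apply j).comp hgrad)
  rw [hset, isOpen_iff_eventually]
  intro V hV
  -- Tube lemma: each alternative is an open condition on (V, d), and compactness in d gives one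
  -- neighbourhood of V that works for the whole sphere.
  refine (isCompact_sphere (0 : Fin n → ℂ) 1).eventually_forall_of_forall_eventually
    fun d hd => ?_
  rcases hV d hd with h | h
  · have hc : Continuous fun x : homogeneousSubmodule (Fin n) ℂ k × (Fin n → ℂ) =>
        sqNorm x.2 • grad (x.1 : MvPolynomial (Fin n) ℂ) x.2 - gradInner x.1.1 x.2 • x.2 :=
      (hsq.smul hgrad).sub (hinner.smul continuous_snd)
    have hne := (hc.continuousAt (x := (V, d))).eventually_ne (y := 0) h
    exact hne.mono fun _ h => Or.inl h
  · have hc : Continuous fun x : homogeneousSubmodule (Fin n) ℂ k × (Fin n → ℂ) =>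
        (sqNorm x.2 • hess (x.1 : MvPolynomial (Fin n) ℂ) x.2 -
          gradInner x.1.1 x.2 • (1 : Matrix (Fin n) (Fin n) ℂ)).det :=
      ((hsq.smul hhess).sub (hinner.smul continuous_const)).matrix_det
    have hne := (hc.continuousAt (x := (V, d))).eventually_ne (y := 0) h
    exact hne.mono fun _ h => Or.inr h

theorem nonempty_genericPotentials (hk : 2 < k) : (genericPotentials n k).Nonempty := by
  have hV : (∑ j, X j ^ k : MvPolynomial (Fin n) ℂ).IsHomogeneous k :=
    IsHomogeneous.sum _ _ _ fun j _ => isHomogeneous_X_pow j k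
  exact ⟨⟨_, hV⟩, (isGeneric_iff_isNondegenerate hk hV).2 (isNondegenerate_sum_X_pow hk)⟩

end Generic

end DarbouxPoints

end

theorem mainTheorem8 (n k : ℕ) (hn : 1 ≤ n) (hk : 2 < k) :
    (DarbouxPoints.genericPotentials n k).Nonempty ∧
    IsOpen[moduleTopology ℂ (MvPolynomial.homogeneousSubmodule (Fin n) ℂ k)]
      (DarbouxPoints.genericPotentials n k) ∧
    ∀ V ∈ DarbouxPoints.genericPotentials n k,
      (DarbouxPoints.properDarbouxPoints (V : MvPolynomial (Fin n) ℂ)).Finite ∧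
      ((DarbouxPoints.properDarbouxPoints (V : MvPolynomial (Fin n) ℂ)).ncard : ℚ) =
        DarbouxPoints.D n k := by
  refine ⟨DarbouxPoints.nonempty_genericPotentials hk,
    DarbouxPoints.isOpen_genericPotentials hk, fun V hV => ?_⟩
  have h := (DarbouxPoints.isGeneric_iff_isNondegenerate hk V.2).1 hV
  exact ⟨DarbouxPoints.finite_properDarbouxPoints hk V.2 fun d hd => h.grad_ne_zero hk V.2 hd,
    DarbouxPoints.ncard_properDarbouxPoints hk V.2 h⟩
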